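/- Let $n$ be a positive integer. The partition monoid $\mathfrak{C}_n$ consists of all set partitions of $2n$ points, namely upper points $1,\dots,n$ and lower points $1',\dots,n'$, where $i'$ lies directly below $i$. The product of $I$ and $J$ is obtained by placing $I$ above $J$, identifying the lower points of $I$ with the upper points of $J$, taking the join of the two partitions, and discarding the middle row; the identity $1$ has blocks $\{k,k'\}$, $1\le k\le n$. Let $\mathcal{PP}_n$ be the submonoid of planar partitions, i.e. those that are noncrossing when the $2n$ points are placed on a circle in the order $1,\dots,n,n',\dots,1'$. For partitions $I,J$ write $I\preceq J$ if every block of $J$ is a union of blocks of $I$. For $1\le i\le n$ let $\mathbf r_i\in\mathfrak{C}_n$ be the partition with blocks $\{i\}$, $\{i'\}$ and $\{k,k'\}$ for $k\ne i$, and for $1\le i\le n-1$ let $\mathbf h_i\in\mathfrak{C}_n$ be the partition with blocks $\{i,i+1,i',(i+1)'\}$ and $\{k,k'\}$ for $k\ne i,i+1$. Let $\mathcal I_n$ be the submonoid of $\mathfrak{C}_n$ generated by $\mathbf r_1,\dots,\mathbf r_n$. The planar ramified monoid $\mathcal{PR}(\mathcal I_n)$ is the set of all pairs $(I,J)$ with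 $I\in\mathcal I_n$, $J\in\mathcal{PP}_n$ and $I\preceq J$, with componentwise multiplication; it is a submonoid of $\mathfrak{C}_n\times\mathfrak{C}_n$. Put $$r_i=(\mathbf r_i,\mathbf r_i),\qquad q_i=(\mathbf r_i,1)\qquad(1\le i\le n),\qquad e_i=(1,\mathbf h_i)\qquad(1\le i\le n-1).$$ **Theorem.** The monoid $\mathcal{PR}(\mathcal I_n)$ is generated by $r_1,\dots,r_n$, $q_1,\dots,q_n$, $e_1,\dots,e_{n-1}$, and it is presented, as a monoid on these generators, by the following relations (for all indices for which they make sense): \begin{align*} & r_i^2=r_i,\quad r_ir_j=r_jr_i; && e_i^2=e_i,\quad e_ie_j=e_je_i;\\ & q_i^2=q_i,\quad q_iq_j=q_jq_i; && q_ie_j=e_jq_i;\\ & e_ir_je_i=e_iq_j\ \text{ if } j\in\{i,i+1\}; && e_ir_j=r_je_i\ \text{ if } j\notin\{i,i+1\};\\ & r_iq_j=q_jr_i,\quad q_ir_i=r_i; && r_je_ir_j=r_j\ \text{ if } j\in\{i,i+1\}. \end{align*} That is, the monoid defined by these generators and relations is isomorphic to $\mathcal{PR}(\mathcal I_n)$ by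 an isomorphism sending each generator to the element of the same name. -/

import Mathlib

namespace PlanarRam

/-! ### Set partitions as equivalence relations

A set partition of `A` is a `Setoid A`; the refinement order is the order of `Setoid A`
(`I ≤ J` iff every block of `J` is a union of blocks of `I`), and the join is `I ⊔ J`. -/

theorem map_le_iff {A B : Type*} (r : Setoid A) (f : A → B) (s : Setoid B) :
    r.map f ≤ s ↔ r ≤ s.comap f := by
  constructor
  · intro h x y hxy
    exact h (Relation.EqvGen.rel _ _ ⟨x, y, hxy, rfl, rfl⟩)
  · intro h
    apply Setoid.eqvGen_le
    rintro _ _ ⟨x, y, hxy, rfl, rfl⟩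
    exact h hxy

theorem map_sup {A B : Type*} (r s : Setoid A) (f : A → B) :
    (r ⊔ s).map f = r.map f ⊔ s.map f :=
  eq_of_forall_ge_iff fun t => by
    simp only [map_le_iff, sup_le_iff]

theorem map_map {A B C : Type*} (r : Setoid A) (f : A → B) (g : B → C) :
    (r.map f).map g = r.map (g ∘ f) :=
  eq_of_forall_ge_iff fun t => by
    simp only [map_le_iff]; rfl

theorem map_apply {A B : Type*} (r : Setoid A) {f : A → B} (hf : Function.Injective f)
    (x y : B) : r.map f x y ↔ x = y ∨ ∃ a b, f a = x ∧ f b = y ∧ r a b := by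
  constructor
  · intro h
    have key : r.map f ≤
        { r := fun x y => x = y ∨ ∃ a b, f a = x ∧ f b = y ∧ r a b
          iseqv := by
            refine ⟨fun _ => Or.inl rfl, ?_, ?_⟩
            · rintro x y (rfl | ⟨a, b, rfl, rfl, h⟩)
              · exact Or.inl rfl
              · exact Or.inr ⟨b, a, rfl, rfl, r.symm' h⟩
            · rintro x y z (rfl | ⟨a, b, rfl, rfl, h⟩) (rfl | ⟨c, d, hc, rfl, h'⟩)
              · exact Or.inl rfl
              · exact Or.inr ⟨c, d, hc, rfl, h'⟩
              · exact Or.inr ⟨a, b, rfl, rfl, h⟩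
              · rw [hf hc] at h'
                exact Or.inr ⟨a, d, rfl, rfl, r.trans' h h'⟩ } := by
      rw [map_le_iff]
      intro a b hab
      exact Or.inr ⟨a, b, rfl, rfl, hab⟩
    exact key h
  · rintro (rfl | ⟨a, b, rfl, rfl, h⟩)
    · exact Setoid.refl' _ _
    · exact Relation.EqvGen.rel _ _ ⟨a, b, h, rfl, rfl⟩

theorem comap_sup_map {X V : Type*} (f : X → V) (p : Setoid V) (k : Setoid X) :
    (p ⊔ k.map f).comap f = p.comap f ⊔ k := by
  apply le_antisymm
  · have key : p ⊔ k.map f ≤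
        { r := fun u v => p u v ∨ ∃ a b, p u (f a) ∧ (p.comap f ⊔ k) a b ∧ p (f b) v
          iseqv := by
            refine ⟨fun u => Or.inl (p.refl' u), ?_, ?_⟩
            · rintro u v (h | ⟨a, b, h1, h2, h3⟩)
              · exact Or.inl (p.symm' h)
              · exact Or.inr ⟨b, a, p.symm' h3, Setoid.symm' _ h2, p.symm' h1⟩
            · rintro u v w (h | ⟨a, b, h1, h2, h3⟩) (h' | ⟨c, d, h4, h5, h6⟩)
              · exact Or.inl (p.trans' h h')
              · exact Or.inr ⟨c, d, p.trans' h h4, h5, h6⟩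
              · exact Or.inr ⟨a, b, h1, h2, p.trans' h3 h'⟩
              · have hbc : (p.comap f ⊔ k) b c :=
                  (le_sup_left : p.comap f ≤ p.comap f ⊔ k) (p.trans' h3 h4)
                exact Or.inr ⟨a, d, h1, Setoid.trans' _ h2 (Setoid.trans' _ hbc h5), h6⟩ } := by
      apply sup_le
      · intro u v h
        exact Or.inl h
      · rw [map_le_iff]
        intro a b h
        exact Or.inr ⟨a, b, p.refl' _, (le_sup_right : k ≤ p.comap f ⊔ k) h, p.refl' _⟩
    intro x y h
    rcases key h with h | ⟨a, b, h1, h2, h3⟩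
    · exact (le_sup_left : p.comap f ≤ p.comap f ⊔ k) h
    · have h1' : (p.comap f ⊔ k) x a := (le_sup_left : p.comap f ≤ p.comap f ⊔ k) h1
      have h3' : (p.comap f ⊔ k) b y := (le_sup_left : p.comap f ≤ p.comap f ⊔ k) h3
      exact Setoid.trans' _ h1' (Setoid.trans' _ h2 h3')
  · apply sup_le
    · intro x y h
      exact (le_sup_left : p ≤ p ⊔ k.map f) h
    · rw [← map_le_iff]
      exact le_sup_right

/-! ### Concatenation -/

/-- The join, on three rows of points, of a partition of the upper two rows and a partition of
the lower two rows. -/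
def stack {α β γ : Type*} (I : Setoid (α ⊕ β)) (J : Setoid (β ⊕ γ)) : Setoid (α ⊕ β ⊕ γ) :=
  I.map (Sum.map id Sum.inl) ⊔ J.map Sum.inr

/-- Concatenation: stack the two diagrams, join, and forget the middle row. -/
def concat {α β γ : Type*} (I : Setoid (α ⊕ β)) (J : Setoid (β ⊕ γ)) : Setoid (α ⊕ γ) :=
  (stack I J).comap (Sum.map id Sum.inr)

theorem concat_apply {α β γ : Type*} (I : Setoid (α ⊕ β)) (J : Setoid (β ⊕ γ)) (x y : α ⊕ γ) :
    concat I J x y ↔ stack I J (Sum.map id Sum.inr x) (Sum.map id Sum.inr y) := Iff.rfl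

theorem stack_mono {α β γ : Type*} {I I' : Setoid (α ⊕ β)} {J J' : Setoid (β ⊕ γ)}
    (hI : I ≤ I') (hJ : J ≤ J') : stack I J ≤ stack I' J' := by
  refine sup_le_sup ?_ ?_
  · exact (map_le_iff _ _ _).2 (hI.trans Setoid.le_comap_map)
  · exact (map_le_iff _ _ _).2 (hJ.trans Setoid.le_comap_map)

theorem concat_mono {α β γ : Type*} {I I' : Setoid (α ⊕ β)} {J J' : Setoid (β ⊕ γ)}
    (hI : I ≤ I') (hJ : J ≤ J') : concat I J ≤ concat I' J' :=
  fun _ _ h => stack_mono hI hJ h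

theorem concat_assoc {α β γ δ : Type*} (I : Setoid (α ⊕ β)) (J : Setoid (β ⊕ γ))
    (K : Setoid (γ ⊕ δ)) : concat (concat I J) K = concat I (concat J K) := by
  -- the joins over all four rows agree
  have left : concat (concat I J) K =
      (I.map (Sum.map id Sum.inl : α ⊕ β → α ⊕ β ⊕ γ ⊕ δ) ⊔
        J.map (Sum.inr ∘ Sum.map id Sum.inl : β ⊕ γ → α ⊕ β ⊕ γ ⊕ δ) ⊔
        K.map (Sum.inr ∘ Sum.inr : γ ⊕ δ → α ⊕ β ⊕ γ ⊕ δ)).comap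
          (Sum.map id (Sum.inr ∘ Sum.inr)) := by
    have hf : Function.Injective
        (Sum.map id (Sum.map id Sum.inl) : α ⊕ β ⊕ γ → α ⊕ β ⊕ γ ⊕ δ) :=
      Function.Injective.sumMap Function.injective_id
        (Function.Injective.sumMap Function.injective_id Sum.inl_injective)
    have hg : Function.Injective (Sum.map id Sum.inl : α ⊕ γ → α ⊕ γ ⊕ δ) :=
      Function.Injective.sumMap Function.injective_id Sum.inl_injective
    have e1 : I.map (Sum.map id Sum.inl : α ⊕ β → α ⊕ β ⊕ γ ⊕ δ) ⊔
        J.map (Sum.inr ∘ Sum.map id Sum.inl : β ⊕ γ → α ⊕ β ⊕ γ ⊕ δ) =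
        (stack I J).map (Sum.map id (Sum.map id Sum.inl)) := by
      rw [stack, map_sup, map_map, map_map]
      congr 2
      funext x
      rcases x with x | x <;> rfl
    have e2 : K.map (Sum.inr ∘ Sum.inr : γ ⊕ δ → α ⊕ β ⊕ γ ⊕ δ) =
        (K.map (Sum.inr : γ ⊕ δ → α ⊕ γ ⊕ δ)).map (Sum.map id Sum.inr) := by
      rw [map_map]; rfl
    have e3 : ((stack I J).map
        (Sum.map id (Sum.map id Sum.inl) : α ⊕ β ⊕ γ → α ⊕ β ⊕ γ ⊕ δ)).comap
        (Sum.map id Sum.inr : α ⊕ γ ⊕ δ → α ⊕ β ⊕ γ ⊕ δ) =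
        (concat I J).map (Sum.map id Sum.inl) := by
      ext x y
      rw [Setoid.comap_rel, map_apply _ hf, map_apply _ hg]
      rcases x with x | x | x <;> rcases y with y | y | y <;> simp [concat_apply]
    rw [e1, e2]
    rw [concat, stack, ← e3, ← comap_sup_map, ← Setoid.comap_comp]
    congr 1
    funext x
    rcases x with x | x <;> rfl
  have right : concat I (concat J K) =
      (I.map (Sum.map id Sum.inl : α ⊕ β → α ⊕ β ⊕ γ ⊕ δ) ⊔
        J.map (Sum.inr ∘ Sum.map id Sum.inl : β ⊕ γ → α ⊕ β ⊕ γ ⊕ δ) ⊔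
        K.map (Sum.inr ∘ Sum.inr : γ ⊕ δ → α ⊕ β ⊕ γ ⊕ δ)).comap
          (Sum.map id (Sum.inr ∘ Sum.inr)) := by
    have hf : Function.Injective (Sum.inr : β ⊕ γ ⊕ δ → α ⊕ β ⊕ γ ⊕ δ) := Sum.inr_injective
    have hg : Function.Injective (Sum.inr : β ⊕ δ → α ⊕ β ⊕ δ) := Sum.inr_injective
    have e1 : J.map (Sum.inr ∘ Sum.map id Sum.inl : β ⊕ γ → α ⊕ β ⊕ γ ⊕ δ) ⊔
        K.map (Sum.inr ∘ Sum.inr : γ ⊕ δ → α ⊕ β ⊕ γ ⊕ δ) = (stack J K).map Sum.inr := by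
      rw [stack, map_sup, map_map, map_map]
    have e2 : I.map (Sum.map id Sum.inl : α ⊕ β → α ⊕ β ⊕ γ ⊕ δ) =
        (I.map (Sum.map id Sum.inl : α ⊕ β → α ⊕ β ⊕ δ)).map
          (Sum.map id (Sum.map id Sum.inr)) := by
      rw [map_map]
      congr 1
      funext x
      rcases x with x | x <;> rfl
    have e3 : ((stack J K).map (Sum.inr : β ⊕ γ ⊕ δ → α ⊕ β ⊕ γ ⊕ δ)).comap
        (Sum.map id (Sum.map id Sum.inr) : α ⊕ β ⊕ δ → α ⊕ β ⊕ γ ⊕ δ) =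
        (concat J K).map Sum.inr := by
      ext x y
      rw [Setoid.comap_rel, map_apply _ hf, map_apply _ hg]
      rcases x with x | x | x <;> rcases y with y | y | y <;> simp [concat_apply]
    rw [sup_assoc, e1, e2, sup_comm]
    rw [concat, stack, sup_comm, ← e3, ← comap_sup_map, ← Setoid.comap_comp]
    congr 1
    funext x
    rcases x with x | x <;> rfl
  rw [left, right]

theorem one_concat {α γ : Type*} (J : Setoid (α ⊕ γ)) :
    concat (Setoid.ker (Sum.elim id id : α ⊕ α → α)) J = J := by
  have vert : ∀ a : α, stack (Setoid.ker (Sum.elim id id : α ⊕ α → α)) J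
      (Sum.inl a) (Sum.inr (Sum.inl a)) := fun a =>
    le_sup_left (a := Setoid.map _ _) (b := Setoid.map J _)
      (Relation.EqvGen.rel _ _ ⟨Sum.inl a, Sum.inr a, rfl, rfl, rfl⟩)
  have coll : ∀ x : α ⊕ γ, stack (Setoid.ker (Sum.elim id id : α ⊕ α → α)) J
      (Sum.map id Sum.inr x) (Sum.inr x) := by
    rintro (a | c)
    · exact vert a
    · exact Setoid.refl' _ _
  apply le_antisymm
  · have key : stack (Setoid.ker (Sum.elim id id : α ⊕ α → α)) J ≤
        J.comap (Sum.elim Sum.inl id) := by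
      refine sup_le ((map_le_iff _ _ _).2 ?_) ((map_le_iff _ _ _).2 ?_)
      · rintro (x | x) (y | y) h <;> obtain rfl : x = y := h <;> exact J.refl' _
      · intro x y h
        exact h
    intro x y h
    have := key h
    rcases x with x | x <;> rcases y with y | y <;> exact this
  · intro x y h
    rw [concat_apply]
    refine Setoid.trans' _ (coll x) (Setoid.trans' _ ?_ (Setoid.symm' _ (coll y)))
    exact le_sup_right (a := Setoid.map _ _) (b := Setoid.map J _)
      (Relation.EqvGen.rel _ _ ⟨x, y, h, rfl, rfl⟩)

theorem concat_one {α β : Type*} (I : Setoid (α ⊕ β)) :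
    concat I (Setoid.ker (Sum.elim id id : β ⊕ β → β)) = I := by
  have vert : ∀ b : β, stack I (Setoid.ker (Sum.elim id id : β ⊕ β → β))
      (Sum.inr (Sum.inr b)) (Sum.inr (Sum.inl b)) := fun b =>
    le_sup_right (a := Setoid.map _ _) (b := Setoid.map _ Sum.inr)
      (Relation.EqvGen.rel _ _ ⟨Sum.inr b, Sum.inl b, rfl, rfl, rfl⟩)
  have coll : ∀ x : α ⊕ β, stack I (Setoid.ker (Sum.elim id id : β ⊕ β → β))
      (Sum.map id Sum.inr x) (Sum.map id Sum.inl x) := by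
    rintro (a | b)
    · exact Setoid.refl' _ _
    · exact vert b
  apply le_antisymm
  · have key : stack I (Setoid.ker (Sum.elim id id : β ⊕ β → β)) ≤
        I.comap (Sum.map id (Sum.elim id id)) := by
      refine sup_le ((map_le_iff _ _ _).2 ?_) ((map_le_iff _ _ _).2 ?_)
      · rintro (x | x) (y | y) h <;> exact h
      · rintro (x | x) (y | y) h <;> obtain rfl : x = y := h <;> exact I.refl' _
    intro x y h
    have := key h
    rcases x with x | x <;> rcases y with y | y <;> exact this
  · intro x y h
    rw [concat_apply]
    refine Setoid.trans' _ (coll x) (Setoid.trans' _ ?_ (Setoid.symm' _ (coll y)))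
    exact le_sup_left (a := Setoid.map _ _) (b := Setoid.map _ _)
      (Relation.EqvGen.rel _ _ ⟨x, y, h, rfl, rfl⟩)

/-! ### The partition monoid -/

/-- The partition monoid: set partitions of `2n` points, `Sum.inl i` being the `i`-th upper point
and `Sum.inr i` the lower point directly below it. -/
abbrev Ptn (n : ℕ) : Type := Setoid (Fin n ⊕ Fin n)

instance instMonoidPtn (n : ℕ) : Monoid (Ptn n) where
  mul I J := concat I J
  mul_assoc := concat_assoc
  one := Setoid.ker (Sum.elim id id)
  one_mul := one_concat
  mul_one := concat_one

theorem mul_def {n : ℕ} (I J : Ptn n) : I * J = concat I J := rfl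

theorem one_apply {n : ℕ} (x y : Fin n ⊕ Fin n) :
    (1 : Ptn n) x y ↔ Sum.elim id id x = Sum.elim id id y := Iff.rfl

/-- The clockwise position (from `0` to `2n - 1`) of a point: the upper row from left to right,
then the lower row from right to left. -/
def pos {n : ℕ} : Fin n ⊕ Fin n → ℤ :=
  Sum.elim (fun i => (i : ℤ)) (fun i => 2 * (n : ℤ) - 1 - (i : ℤ))

/-- A partition of the `2n` boundary points of the rectangle is planar if its blocks can be drawn
without crossings: no two different blocks interlace. -/
def IsPlanar {n : ℕ} (I : Ptn n) : Prop :=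
  ∀ a b c d, pos a < pos b → pos b < pos c → pos c < pos d → I a c → I b d → I a b

/-! ### Concatenation preserves planarity -/

theorem pos_injective {n : ℕ} : Function.Injective (pos : Fin n ⊕ Fin n → ℤ) := by
  rintro (x | x) (y | y) h <;> simp only [pos, Sum.elim_inl, Sum.elim_inr] at h <;>
    first
      | (congr 1; ext; omega)
      | (exfalso; omega)

/-- The indicator of `a < b`, modulo `2`. -/
def lt2 (a b : ℤ) : ZMod 2 := if a < b then 1 else 0

theorem lt2_parity {x y u v : ℤ} (n1 : x ≠ u) (n2 : x ≠ v) (n3 : y ≠ u) (n4 : y ≠ v)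
    (c1 : ¬ (x < u ∧ u < y ∧ y < v)) (c2 : ¬ (x < v ∧ v < y ∧ y < u))
    (c3 : ¬ (y < u ∧ u < x ∧ x < v)) (c4 : ¬ (y < v ∧ v < x ∧ x < u))
    (c5 : ¬ (u < x ∧ x < v ∧ v < y)) (c6 : ¬ (u < y ∧ y < v ∧ v < x))
    (c7 : ¬ (v < x ∧ x < u ∧ u < y)) (c8 : ¬ (v < y ∧ y < u ∧ u < x)) :
    lt2 x u + lt2 y u = lt2 x v + lt2 y v := by
  unfold lt2
  have two := CharTwo.add_self_eq_zero (1 : ZMod 2)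
  rcases n1.lt_or_gt with h1 | h1 <;> rcases n2.lt_or_gt with h2 | h2 <;>
  rcases n3.lt_or_gt with h3 | h3 <;> rcases n4.lt_or_gt with h4 | h4 <;>
  simp only [h1, h2, h3, h4, not_lt.2 h1.le, not_lt.2 h2.le, not_lt.2 h3.le, not_lt.2 h4.le,
    if_true, if_false, two, add_zero, zero_add, true_and, and_true, not_true] at *

theorem IsPlanar.parity {n : ℕ} {I : Ptn n} (hI : IsPlanar I) {x y u v : Fin n ⊕ Fin n}
    (hxy : I x y) (huv : I u v) (hxu : ¬ I x u) :
    lt2 (pos x) (pos u) + lt2 (pos y) (pos u) = lt2 (pos x) (pos v) + lt2 (pos y) (pos v) := by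
  have hyx := I.symm' hxy
  have hvu := I.symm' huv
  have hxv : ¬ I x v := fun h => hxu (I.trans' h hvu)
  have hyu : ¬ I y u := fun h => hxu (I.trans' hxy h)
  have hyv : ¬ I y v := fun h => hxu (I.trans' hxy (I.trans' h hvu))
  have hux : ¬ I u x := fun h => hxu (I.symm' h)
  have hvx : ¬ I v x := fun h => hxv (I.symm' h)
  have huy : ¬ I u y := fun h => hyu (I.symm' h)
  have hvy : ¬ I v y := fun h => hyv (I.symm' h)
  have ne : ∀ {p q : Fin n ⊕ Fin n}, ¬ I p q → pos p ≠ pos q := fun h e =>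
    h (pos_injective e ▸ I.refl' _)
  have n1 := ne hxu
  have n2 := ne hxv
  have n3 := ne hyu
  have n4 := ne hyv
  have c1 : ¬ (pos x < pos u ∧ pos u < pos y ∧ pos y < pos v) :=
    fun h => hxu (hI x u y v h.1 h.2.1 h.2.2 hxy huv)
  have c2 : ¬ (pos x < pos v ∧ pos v < pos y ∧ pos y < pos u) :=
    fun h => hxv (hI x v y u h.1 h.2.1 h.2.2 hxy hvu)
  have c3 : ¬ (pos y < pos u ∧ pos u < pos x ∧ pos x < pos v) :=
    fun h => hyu (hI y u x v h.1 h.2.1 h.2.2 hyx huv)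
  have c4 : ¬ (pos y < pos v ∧ pos v < pos x ∧ pos x < pos u) :=
    fun h => hyv (hI y v x u h.1 h.2.1 h.2.2 hyx hvu)
  have c5 : ¬ (pos u < pos x ∧ pos x < pos v ∧ pos v < pos y) :=
    fun h => hux (hI u x v y h.1 h.2.1 h.2.2 huv hxy)
  have c6 : ¬ (pos u < pos y ∧ pos y < pos v ∧ pos v < pos x) :=
    fun h => huy (hI u y v x h.1 h.2.1 h.2.2 huv hyx)
  have c7 : ¬ (pos v < pos x ∧ pos x < pos u ∧ pos u < pos y) :=
    fun h => hvx (hI v x u y h.1 h.2.1 h.2.2 hvu hxy)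
  have c8 : ¬ (pos v < pos y ∧ pos y < pos u ∧ pos u < pos x) :=
    fun h => hvy (hI v y u x h.1 h.2.1 h.2.2 hvu hyx)
  exact lt2_parity n1 n2 n3 n4 c1 c2 c3 c4 c5 c6 c7 c8

/-- Positions around the upper rectangle of a three-row diagram, with the bottom row last. -/
def posU {n : ℕ} : Fin n ⊕ Fin n ⊕ Fin n → ℤ :=
  Sum.elim (fun i => (i : ℤ)) (Sum.elim (fun i => 2 * (n : ℤ) - 1 - (i : ℤ)) fun _ => 2 * n)

/-- Positions around the lower rectangle of a three-row diagram, with the top row first. -/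
def posL {n : ℕ} : Fin n ⊕ Fin n ⊕ Fin n → ℤ := Sum.elim (fun _ => -1) pos

/-- The indicator of the bottom row, modulo `2`. -/
def bot2 {n : ℕ} : Fin n ⊕ Fin n ⊕ Fin n → ZMod 2 :=
  Sum.elim 0 (Sum.elim 0 1)

theorem posU_map {n : ℕ} (x : Fin n ⊕ Fin n) : posU (Sum.map id Sum.inl x) = pos x := by
  rcases x with x | x <;> rfl

theorem posL_inr {n : ℕ} (x : Fin n ⊕ Fin n) : posL (Sum.inr x) = pos x := rfl

theorem zmod_two_self (x : ZMod 2) : x + x = 0 := CharTwo.add_self_eq_zero x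

theorem exists_colouring {n : ℕ} {I J : Ptn n} (hI : IsPlanar I) (hJ : IsPlanar J)
    {a x : Fin n ⊕ Fin n ⊕ Fin n} (hax : stack I J a x) :
    ∃ S T : Fin n ⊕ Fin n ⊕ Fin n → ZMod 2,
      (∀ u v, I u v → ¬ stack I J a (Sum.map id Sum.inl u) →
        S (Sum.map id Sum.inl u) = S (Sum.map id Sum.inl v)) ∧
      (∀ u v, J u v → ¬ stack I J a (Sum.inr u) → T (Sum.inr u) = T (Sum.inr v)) ∧
      (∀ i, S (Sum.inl i) = lt2 (posU a) (posU (Sum.inl i : Fin n ⊕ Fin n ⊕ Fin n)) +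
        lt2 (posU x) (posU (Sum.inl i : Fin n ⊕ Fin n ⊕ Fin n))) ∧
      (∀ i, T (Sum.inr (Sum.inr i)) =
        lt2 (posL a) (posL (Sum.inr (Sum.inr i) : Fin n ⊕ Fin n ⊕ Fin n)) +
        lt2 (posL x) (posL (Sum.inr (Sum.inr i) : Fin n ⊕ Fin n ⊕ Fin n))) ∧
      (∀ i, ¬ stack I J a (Sum.inr (Sum.inl i)) →
        S (Sum.inr (Sum.inl i)) + T (Sum.inr (Sum.inl i)) =
          lt2 (posU a) (posU (Sum.inr (Sum.inl i) : Fin n ⊕ Fin n ⊕ Fin n)) + bot2 a +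
          (lt2 (posU x) (posU (Sum.inr (Sum.inl i) : Fin n ⊕ Fin n ⊕ Fin n)) + bot2 x)) := by
  let P : Fin n ⊕ Fin n ⊕ Fin n → Prop := fun x => stack I J a x ∧
    ∃ S T : Fin n ⊕ Fin n ⊕ Fin n → ZMod 2,
      (∀ u v, I u v → ¬ stack I J a (Sum.map id Sum.inl u) →
        S (Sum.map id Sum.inl u) = S (Sum.map id Sum.inl v)) ∧
      (∀ u v, J u v → ¬ stack I J a (Sum.inr u) → T (Sum.inr u) = T (Sum.inr v)) ∧
      (∀ i, S (Sum.inl i) = lt2 (posU a) (posU (Sum.inl i : Fin n ⊕ Fin n ⊕ Fin n)) +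
        lt2 (posU x) (posU (Sum.inl i : Fin n ⊕ Fin n ⊕ Fin n))) ∧
      (∀ i, T (Sum.inr (Sum.inr i)) =
        lt2 (posL a) (posL (Sum.inr (Sum.inr i) : Fin n ⊕ Fin n ⊕ Fin n)) +
        lt2 (posL x) (posL (Sum.inr (Sum.inr i) : Fin n ⊕ Fin n ⊕ Fin n))) ∧
      (∀ i, ¬ stack I J a (Sum.inr (Sum.inl i)) →
        S (Sum.inr (Sum.inl i)) + T (Sum.inr (Sum.inl i)) =
          lt2 (posU a) (posU (Sum.inr (Sum.inl i) : Fin n ⊕ Fin n ⊕ Fin n)) + bot2 a +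
          (lt2 (posU x) (posU (Sum.inr (Sum.inl i) : Fin n ⊕ Fin n ⊕ Fin n)) + bot2 x))
  suffices h : ∀ x, stack I J a x → P x from (h x hax).2
  have leI : I.map (Sum.map id Sum.inl) ≤ stack I J := le_sup_left
  have leJ : J.map Sum.inr ≤ stack I J := le_sup_right
  have stepI : ∀ x y, I x y → P (Sum.map id Sum.inl x) → P (Sum.map id Sum.inl y) := by
    rintro x y hxy ⟨hx, S, T, h1, h2, h3, h4, h5⟩
    have hxy' : stack I J (Sum.map id Sum.inl x) (Sum.map id Sum.inl y) :=
      leI (Setoid.le_comap_map hxy)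
    refine ⟨Setoid.trans' _ hx hxy', fun v => S v +
      (lt2 (posU (Sum.map id Sum.inl x : Fin n ⊕ Fin n ⊕ Fin n)) (posU v) +
        lt2 (posU (Sum.map id Sum.inl y : Fin n ⊕ Fin n ⊕ Fin n)) (posU v)),
      T, ?_, h2, ?_, ?_, ?_⟩
    · intro u v huv hu
      have hxu : ¬ I x u := fun h => hu (Setoid.trans' _ hx (leI (Setoid.le_comap_map h)))
      simp only [posU_map]
      rw [h1 u v huv hu, hI.parity hxy huv hxu]
    · intro i
      simp only [h3]
      linear_combination zmod_two_self
        (lt2 (posU (Sum.map id Sum.inl x)) (posU (Sum.inl i : Fin n ⊕ Fin n ⊕ Fin n)))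
    · intro i
      rw [h4]
      congr 1
      rcases x with x | x <;> rcases y with y | y <;> simp [lt2, posL, pos] <;> grind
    · intro i hi
      have := h5 i hi
      have hb : ∀ z : Fin n ⊕ Fin n, bot2 (Sum.map id Sum.inl z) = 0 := by
        rintro (z | z) <;> rfl
      simp only [hb] at this ⊢
      linear_combination this + zmod_two_self
        (lt2 (posU (Sum.map id Sum.inl x)) (posU (Sum.inr (Sum.inl i) : Fin n ⊕ Fin n ⊕ Fin n)))
  have stepJ : ∀ x y, J x y → P (Sum.inr x) → P (Sum.inr y) := by
    rintro x y hxy ⟨hx, S, T, h1, h2, h3, h4, h5⟩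
    have hxy' : stack I J (Sum.inr x) (Sum.inr y) := leJ (Setoid.le_comap_map hxy)
    have hy := Setoid.trans' _ hx hxy'
    refine ⟨hy, S, fun v => T v +
      (lt2 (posL (Sum.inr x : Fin n ⊕ Fin n ⊕ Fin n)) (posL v) +
        lt2 (posL (Sum.inr y : Fin n ⊕ Fin n ⊕ Fin n)) (posL v)), h1, ?_, ?_, ?_, ?_⟩
    · intro u v huv hu
      have hxu : ¬ J x u := fun h => hu (Setoid.trans' _ hx (leJ (Setoid.le_comap_map h)))
      simp only [posL_inr]
      rw [h2 u v huv hu, hJ.parity hxy huv hxu]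
    · intro i
      rw [h3]
      congr 1
      rcases x with x | x <;> rcases y with y | y <;> simp [lt2, posU] <;> grind
    · intro i
      simp only [h4]
      linear_combination zmod_two_self
        (lt2 (posL (Sum.inr x)) (posL (Sum.inr (Sum.inr i) : Fin n ⊕ Fin n ⊕ Fin n)))
    · intro i hi
      have := h5 i hi
      have hb : ∀ z : Fin n ⊕ Fin n, stack I J a (Sum.inr z) →
          lt2 (posU (Sum.inr z)) (posU (Sum.inr (Sum.inl i) : Fin n ⊕ Fin n ⊕ Fin n)) +
            bot2 (Sum.inr z) =
          1 + lt2 (posL (Sum.inr z)) (posL (Sum.inr (Sum.inl i) : Fin n ⊕ Fin n ⊕ Fin n)) := by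
        rintro (z | z) hz
        · have hzi : z ≠ i := by
            rintro rfl
            exact hi hz
          have hzi' : (z : ℕ) ≠ i := fun h => hzi (Fin.ext h)
          simp only [posU, posL, pos, bot2, Sum.elim_inl, Sum.elim_inr, Pi.zero_apply]
          (unfold lt2; split_ifs) <;> first | (simp [CharTwo.add_self_eq_zero]; done) | (exfalso; omega)
        · simp only [posU, posL, pos, bot2, Sum.elim_inl, Sum.elim_inr, Pi.one_apply]
          (unfold lt2; split_ifs) <;> first | (simp [CharTwo.add_self_eq_zero]; done) | (exfalso; omega)
      rw [hb x hx] at this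
      rw [hb y hy]
      linear_combination this + zmod_two_self
        (lt2 (posL (Sum.inr x)) (posL (Sum.inr (Sum.inl i) : Fin n ⊕ Fin n ⊕ Fin n)))
  have base : P a := by
    refine ⟨Setoid.refl' _ _, fun _ => 0, fun _ => 0, fun _ _ _ _ => rfl, fun _ _ _ _ => rfl,
      fun i => (zmod_two_self _).symm, fun i => (zmod_two_self _).symm, fun i _ => ?_⟩
    exact (add_zero (0 : ZMod 2)).trans (zmod_two_self _).symm
  let U : Setoid (Fin n ⊕ Fin n ⊕ Fin n) := ⟨fun x y => P x ↔ P y,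
    fun _ => Iff.rfl, fun h => h.symm, fun h h' => h.trans h'⟩
  have hU : stack I J ≤ U := by
    refine sup_le ((map_le_iff _ _ _).2 ?_) ((map_le_iff _ _ _).2 ?_)
    · intro x y h
      exact ⟨stepI x y h, stepI y x (I.symm' h)⟩
    · intro x y h
      exact ⟨stepJ x y h, stepJ y x (J.symm' h)⟩
  intro x hx
  exact (hU hx).1 base

theorem IsPlanar.mul {n : ℕ} {I J : Ptn n} (hI : IsPlanar I) (hJ : IsPlanar J) :
    IsPlanar (I * J) := by
  intro a b c d hab hbc hcd hac hbd
  rw [mul_def, concat_apply] at hac hbd ⊢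
  by_contra hn
  obtain ⟨S, T, h1, h2, h3, h4, h5⟩ := exists_colouring hI hJ hac
  set C : Fin n ⊕ Fin n ⊕ Fin n → Prop := fun v => stack I J (Sum.map id Sum.inr a) v with hC
  have leI : I.map (Sum.map id Sum.inl) ≤ stack I J := le_sup_left
  have leJ : J.map Sum.inr ≤ stack I J := le_sup_right
  have mid : ∀ i, ¬ C (Sum.inr (Sum.inl i)) →
      S (Sum.inr (Sum.inl i)) = T (Sum.inr (Sum.inl i)) := by
    intro i hi
    have hb : ∀ z : Fin n ⊕ Fin n,
        lt2 (posU (Sum.map id Sum.inr z : Fin n ⊕ Fin n ⊕ Fin n))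
          (posU (Sum.inr (Sum.inl i) : Fin n ⊕ Fin n ⊕ Fin n)) +
          bot2 (Sum.map id Sum.inr z) = 1 := by
      rintro (z | z) <;>
      simp only [posU, bot2, Sum.map_inl, Sum.map_inr, id, Sum.elim_inl, Sum.elim_inr,
        Pi.zero_apply, Pi.one_apply] <;>
      (unfold lt2; split_ifs) <;> first | (simp [CharTwo.add_self_eq_zero]; done) | (exfalso; omega)
    have := h5 i hi
    rw [hb, hb, zmod_two_self] at this
    exact CharTwo.add_eq_zero.1 this
  let col : Fin n ⊕ Fin n ⊕ Fin n → ZMod 2 := fun v =>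
    Sum.elim (fun i => S (Sum.inl i)) (fun w => T (Sum.inr w)) v
  have colU : ∀ x : Fin n ⊕ Fin n, ¬ C (Sum.map id Sum.inl x) →
      col (Sum.map id Sum.inl x) = S (Sum.map id Sum.inl x) := by
    rintro (x | x) hx
    · rfl
    · exact (mid x hx).symm
  let U : Setoid (Fin n ⊕ Fin n ⊕ Fin n) :=
    ⟨fun x y => (C x ↔ C y) ∧ (¬ C x → col x = col y),
      fun _ => ⟨Iff.rfl, fun _ => rfl⟩,
      fun h => ⟨h.1.symm, fun hy => (h.2 (fun hx => hy (h.1.1 hx))).symm⟩,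
      fun h h' => ⟨h.1.trans h'.1, fun hx =>
        (h.2 hx).trans (h'.2 fun hy => hx (h.1.2 hy))⟩⟩
  have hU : stack I J ≤ U := by
    refine sup_le ((map_le_iff _ _ _).2 ?_) ((map_le_iff _ _ _).2 ?_)
    · intro x y h
      have hxy := leI (Setoid.le_comap_map h)
      have hc : C (Sum.map id Sum.inl x) ↔ C (Sum.map id Sum.inl y) :=
        ⟨fun hx => Setoid.trans' _ hx hxy, fun hy => Setoid.trans' _ hy (Setoid.symm' _ hxy)⟩
      refine ⟨hc, fun hx => ?_⟩
      rw [colU x hx, colU y fun hy => hx (hc.2 hy)]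
      exact h1 x y h hx
    · intro x y h
      have hxy := leJ (Setoid.le_comap_map h)
      have hc : C (Sum.inr x) ↔ C (Sum.inr y) :=
        ⟨fun hx => Setoid.trans' _ hx hxy, fun hy => Setoid.trans' _ hy (Setoid.symm' _ hxy)⟩
      exact ⟨hc, fun hx => h2 x y h hx⟩
  have outer : ∀ v : Fin n ⊕ Fin n, col (Sum.map id Sum.inr v) =
      lt2 (pos a) (pos v) + lt2 (pos c) (pos v) := by
    rintro (v | v)
    · have hb : ∀ z : Fin n ⊕ Fin n,
          lt2 (posU (Sum.map id Sum.inr z : Fin n ⊕ Fin n ⊕ Fin n))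
            (posU (Sum.inl v : Fin n ⊕ Fin n ⊕ Fin n)) =
          lt2 (pos z) (pos (Sum.inl v : Fin n ⊕ Fin n)) := by
        rintro (z | z) <;>
        simp only [posU, pos, Sum.map_inl, Sum.map_inr, id, Sum.elim_inl, Sum.elim_inr] <;>
        (unfold lt2; split_ifs) <;> first | (simp; done) | (exfalso; omega)
      have := h3 v
      rw [hb, hb] at this
      exact this
    · have hb : ∀ z : Fin n ⊕ Fin n,
          lt2 (posL (Sum.map id Sum.inr z : Fin n ⊕ Fin n ⊕ Fin n))
            (posL (Sum.inr (Sum.inr v) : Fin n ⊕ Fin n ⊕ Fin n)) =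
          lt2 (pos z) (pos (Sum.inr v : Fin n ⊕ Fin n)) := by
        rintro (z | z) <;>
        simp only [posL, pos, Sum.map_inl, Sum.map_inr, id, Sum.elim_inl, Sum.elim_inr] <;>
        (unfold lt2; split_ifs) <;> first | (simp; done) | (exfalso; omega)
      have := h4 v
      rw [hb, hb] at this
      exact this
  have hcol := (hU hbd).2 hn
  rw [outer, outer] at hcol
  have ha : pos a < pos d := by omega
  have hcb : ¬ pos c < pos b := by omega
  simp [lt2, hab, hcd, ha, hcb] at hcol

theorem isPlanar_one (n : ℕ) : IsPlanar (1 : Ptn n) := by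
  intro a b c d hab hbc hcd hac hbd
  rw [one_apply] at hac hbd ⊢
  rcases a with a | a <;> rcases b with b | b <;> rcases c with c | c <;> rcases d with d | d <;>
    simp only [pos, Sum.elim_inl, Sum.elim_inr, id] at * <;> subst_vars <;> omega

/-- The planar partition monoid. -/
def planarPtn (n : ℕ) : Submonoid (Ptn n) where
  carrier := {I | IsPlanar I}
  mul_mem' := IsPlanar.mul
  one_mem' := isPlanar_one n

/-! ### Ramified monoids -/

/-- The ramified monoid of `M`: pairs `(I, J)` with `I ∈ M` and `I` finer than `J`, multiplied
componentwise. -/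
def ramified {n : ℕ} (M : Submonoid (Ptn n)) : Submonoid (Ptn n × Ptn n) where
  carrier := {p | p.1 ∈ M ∧ p.1 ≤ p.2}
  mul_mem' := fun hp hq => ⟨M.mul_mem hp.1 hq.1, concat_mono hp.2 hq.2⟩
  one_mem' := ⟨M.one_mem, le_refl (1 : Ptn n)⟩

/-- The planar ramified monoid of `M`: pairs `(I, J)` with `I ∈ M`, `J` planar and `I` finer
than `J`. -/
def planarRamified {n : ℕ} (M : Submonoid (Ptn n)) : Submonoid (Ptn n × Ptn n) where
  carrier := {p | p.1 ∈ M ∧ p.2 ∈ planarPtn n ∧ p.1 ≤ p.2}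
  mul_mem' := fun hp hq =>
    ⟨M.mul_mem hp.1 hq.1, (planarPtn n).mul_mem hp.2.1 hq.2.1, concat_mono hp.2.2 hq.2.2⟩
  one_mem' := ⟨M.one_mem, (planarPtn n).one_mem, le_refl (1 : Ptn n)⟩

/-! ### Generators -/

/-- The column of a point. -/
def column {n : ℕ} : Fin n ⊕ Fin n → Fin n := Sum.elim id id

/-- The partition `r_i`: two singletons in column `i`, vertical lines in the other columns. -/
abbrev rPtn {n : ℕ} (i : Fin n) : Ptn n where
  r x y := x = y ∨ (column x = column y ∧ column x ≠ i)
  iseqv := by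
    refine ⟨fun _ => Or.inl rfl, ?_, ?_⟩ <;> grind

/-- The `i`-th of the indices `0, …, n - 2`, as an index of a column. -/
def lo {n : ℕ} (i : Fin (n - 1)) : Fin n := ⟨i, by omega⟩

/-- The successor of the `i`-th of the indices `0, …, n - 2`, as an index of a column. -/
def hi {n : ℕ} (i : Fin (n - 1)) : Fin n := ⟨i + 1, by omega⟩

/-- The partition `h_i`: one block consisting of the four points in the columns `i` and `i + 1`,
and vertical lines in the other columns. -/
abbrev hPtn {n : ℕ} (i : Fin (n - 1)) : Ptn n where
  r x y := column x = column y ∨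
    ((column x = lo i ∨ column x = hi i) ∧ (column y = lo i ∨ column y = hi i))
  iseqv := by
    refine ⟨fun _ => Or.inl rfl, ?_, ?_⟩ <;> grind

/-- The monoid generated by `r_1, …, r_n`. -/
def monoidI (n : ℕ) : Submonoid (Ptn n) := Submonoid.closure (Set.range rPtn)

/-- The letters `r_1, …, r_n`, `q_1, …, q_n`, `e_1, …, e_{n-1}`. -/
inductive Gen (n : ℕ) : Type
  | r (i : Fin n) : Gen n
  | q (i : Fin n) : Gen n
  | e (i : Fin (n - 1)) : Gen n

/-- The ramified partitions `r_i = (r_i, r_i)`, `q_i = (r_i, 1)` and `e_i = (1, h_i)`. -/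
def genVal {n : ℕ} : Gen n → Ptn n × Ptn n
  | Gen.r i => (rPtn i, rPtn i)
  | Gen.q i => (rPtn i, 1)
  | Gen.e i => (1, hPtn i)

/-- The letters, as words. -/
def R {n : ℕ} (i : Fin n) : FreeMonoid (Gen n) := FreeMonoid.of (Gen.r i)
/-- The letters, as words. -/
def Q {n : ℕ} (i : Fin n) : FreeMonoid (Gen n) := FreeMonoid.of (Gen.q i)
/-- The letters, as words. -/
def E {n : ℕ} (i : Fin (n - 1)) : FreeMonoid (Gen n) := FreeMonoid.of (Gen.e i)

/-- The defining relations. -/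
inductive Rel (n : ℕ) : FreeMonoid (Gen n) → FreeMonoid (Gen n) → Prop
  | r_idem (i : Fin n) : Rel n (R i * R i) (R i)
  | r_comm (i j : Fin n) : Rel n (R i * R j) (R j * R i)
  | e_idem (i : Fin (n - 1)) : Rel n (E i * E i) (E i)
  | e_comm (i j : Fin (n - 1)) : Rel n (E i * E j) (E j * E i)
  | q_idem (i : Fin n) : Rel n (Q i * Q i) (Q i)
  | q_comm (i j : Fin n) : Rel n (Q i * Q j) (Q j * Q i)
  | q_e (i : Fin n) (j : Fin (n - 1)) : Rel n (Q i * E j) (E j * Q i)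
  | e_r_e (i : Fin (n - 1)) (j : Fin n) (h : j = lo i ∨ j = hi i) :
      Rel n (E i * R j * E i) (E i * Q j)
  | e_r (i : Fin (n - 1)) (j : Fin n) (h : j ≠ lo i ∧ j ≠ hi i) : Rel n (E i * R j) (R j * E i)
  | r_q (i j : Fin n) : Rel n (R i * Q j) (Q j * R i)
  | q_r (i : Fin n) : Rel n (Q i * R i) (R i)
  | r_e_r (i : Fin (n - 1)) (j : Fin n) (h : j = lo i ∨ j = hi i) :
      Rel n (R j * E i * R j) (R j)

end PlanarRam

/-!
The theorem is proved by reducing it to the Jones (Temperley–Lieb) monoid with loop parameter `1`.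
The letters `r_0, e_0, r_1, e_1, …, r_{n-1}`, evaluated in the second component, are the `2n - 1`
Jones generators of the planar partition monoid. The only Jones relation that fails for pairs is
`e_i r_j e_i = e_i`, which here reads `e_i r_j e_i = e_i q_j`.

The letters `q_i` are central idempotents with `q_i r_i = r_i`. Hence an element `w` of the
presented monoid has a content `A`, read off from its first component: if `c` is the product of the
`q_i` with `i ∈ A`, then `w = c * w`, and `c * w = c * z` for a word `z` in the letters `c * e_i`
and the letters `c * r_i` with `i ∈ A` (`exists_content`). These letters satisfy the full Jones
relations (`IsCutIdem.jonesRel`), since `c` absorbs the `q_j`. So two things are needed about a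
subset of the Jones letters, cut out by a set `S` of positions.

*The Jones relations suffice* (`JonesRel.injOn_below`, `injOn_below_of_letter`). The submonoid
generated by the letters `t_l`, `l ≤ m`, is the union of the one generated by the earlier letters
and its multiples by descending runs `t_m ⋯ t_k`. By induction on `m`, elements of this form with
the same value are equal, given three facts about partitions: no partition absorbs two consecutive
letters, right multiplication by `t_m` is injective on partitions generated by earlier letters, and
none of these absorbs `t_m`. Multiplication by an ascending run `t_{k+1} ⋯ t_m` cancels a
descending run down to `t_m`, and runs of different lengths are exchanged by the identities
`t_{l-2} (t_m ⋯ t_k) = (t_{l-2} ⋯ t_k) (t_m ⋯ t_l) = (t_m ⋯ t_k) t_l`.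

*The letters generate enough* (`mem_below_of_isPlanar`). Let `J` be planar with `c` and `c'` joined
for all `c ∉ A`. Each Jones letter acts on two neighbouring strands among the `2n` boundary
strands of the blocks. Let `m` be such that all strands after those of `t_m` go straight down, but
the right-hand strand of `t_m` does not. Followed from its lower end, this strand leads to the left,
hence it turns around at once or encloses a strand that does; the letters in between belong to the
given set and the one at the turn, `t_k`, is absorbed by `J`. Then `J * t_{k+1} ⋯ t_m` absorbs `t_m`,
so it is `K * t_m` with `K` involving fewer letters, and `J = K * t_m ⋯ t_k`.
-/

namespace PlanarRam

/-! ### Monoids with Jones generators -/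

section Jones

variable {M N : Type*} [Monoid M] [Monoid N]

/-- The relations of the Jones (Temperley–Lieb) monoid with loop parameter `1`, imposed on the
letters `t l` with `l ∈ S`. -/
structure JonesRel (t : ℕ → M) (S : Set ℕ) : Prop where
  idem : ∀ l ∈ S, t l * t l = t l
  comm : ∀ k ∈ S, ∀ l ∈ S, k + 2 ≤ l → t l * t k = t k * t l
  up : ∀ l ∈ S, l + 1 ∈ S → t l * t (l + 1) * t l = t l
  down : ∀ l ∈ S, l + 1 ∈ S → t (l + 1) * t l * t (l + 1) = t (l + 1)

/-- The submonoid generated by the letters `t l` with `l ∈ S` and `l < m`. -/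
def below (t : ℕ → M) (S : Set ℕ) (m : ℕ) : Submonoid M :=
  Submonoid.closure (t '' {l | l ∈ S ∧ l < m})

/-- The descending product `t (k + d) * ⋯ * t (k + 1) * t k`. -/
def desc (t : ℕ → M) (k : ℕ) : ℕ → M
  | 0 => t k
  | d + 1 => t (k + d + 1) * desc t k d

/-- The ascending product `t (k + 1) * ⋯ * t (k + d)`. -/
def asc (t : ℕ → M) (k : ℕ) : ℕ → M
  | 0 => 1
  | d + 1 => asc t k d * t (k + d + 1)

variable {t : ℕ → M} {S : Set ℕ}

theorem mem_below {l m : ℕ} (hl : l ∈ S) (hm : l < m) : t l ∈ below t S m :=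
  Submonoid.subset_closure ⟨l, ⟨hl, hm⟩, rfl⟩

theorem below_mono {m m' : ℕ} (h : m ≤ m') : below t S m ≤ below t S m' :=
  Submonoid.closure_mono (Set.image_mono fun _ hl => ⟨hl.1, hl.2.trans_le h⟩)

theorem desc_mem {k d m : ℕ} (hS : ∀ l, k ≤ l → l ≤ k + d → l ∈ S) (hm : k + d < m) :
    desc t k d ∈ below t S m := by
  induction d with
  | zero => exact mem_below (hS k le_rfl le_rfl) hm
  | succ d ih =>
    exact mul_mem (mem_below (hS _ (by omega) (by omega)) (by omega))
      (ih (fun l h1 h2 => hS l h1 (by omega)) (by omega))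

theorem asc_mem {k d m : ℕ} (hS : ∀ l, k ≤ l → l ≤ k + d → l ∈ S) (hm : k + d < m) :
    asc t k d ∈ below t S m := by
  induction d with
  | zero => exact one_mem _
  | succ d ih =>
    exact mul_mem (ih (fun l h1 h2 => hS l h1 (by omega)) (by omega))
      (mem_below (hS _ (by omega) (by omega)) (by omega))

theorem desc_split (k d e : ℕ) :
    desc t k (d + 1 + e) = desc t (k + d + 1) e * desc t k d := by
  induction e with
  | zero => rfl
  | succ e ih =>
    rw [← add_assoc, desc, ih, desc, mul_assoc]
    congr 2; omega

namespace JonesRel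

variable (ht : JonesRel t S)
include ht

theorem letter_mul_desc {k d : ℕ} (hk : k + d ∈ S) : t (k + d) * desc t k d = desc t k d := by
  cases d with
  | zero => exact ht.idem _ hk
  | succ d => rw [desc, ← mul_assoc]; congr 1; exact ht.idem _ hk

theorem desc_mul_letter {k d : ℕ} (hk : k ∈ S) : desc t k d * t k = desc t k d := by
  induction d with
  | zero => exact ht.idem _ hk
  | succ d ih => rw [desc, mul_assoc, ih]

theorem desc_mul_asc {k d : ℕ} (hS : ∀ l, k ≤ l → l ≤ k + d → l ∈ S) :
    desc t k d * asc t k d = t (k + d) := by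
  induction d with
  | zero => exact mul_one _
  | succ d ih =>
    have := ih fun l h1 h2 => hS l h1 (by omega)
    calc desc t k (d + 1) * asc t k (d + 1)
        = t (k + d + 1) * (desc t k d * asc t k d) * t (k + d + 1) := by
          simp only [desc, asc, mul_assoc]
      _ = _ := by
        rw [this]
        exact ht.down _ (hS _ (by omega) (by omega)) (hS _ (by omega) (by omega))

theorem letter_mul_asc_mul_desc {k d : ℕ} (hS : ∀ l, k ≤ l → l ≤ k + d → l ∈ S) :
    t k * asc t k d * desc t k d = t k := by
  induction d with
  | zero => rw [asc, mul_one]; exact ht.idem _ (hS _ le_rfl le_rfl)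
  | succ d ih =>
    have h0 : k + d ∈ S := hS _ (by omega) (by omega)
    have h1 : k + d + 1 ∈ S := hS _ (by omega) (by omega)
    have ha : t k * asc t k d * t (k + d) = t k * asc t k d := by
      cases d with
      | zero => simp only [asc, mul_one]; exact ht.idem _ h0
      | succ d => simp only [asc, mul_assoc]; congr 2; exact ht.idem _ h0
    calc t k * asc t k (d + 1) * desc t k (d + 1)
        = t k * asc t k d * (t (k + d + 1) * t (k + d + 1)) * desc t k d := by
          simp only [desc, asc, mul_assoc]
      _ = t k * asc t k d * t (k + d) * t (k + d + 1) * (t (k + d) * desc t k d) := by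
          rw [ht.idem _ h1, ht.letter_mul_desc h0, ha]
      _ = t k * asc t k d * (t (k + d) * t (k + d + 1) * t (k + d)) * desc t k d := by
          simp only [mul_assoc]
      _ = t k := by
          rw [ht.up _ h0 h1, ha]
          exact ih fun l h1 h2 => hS l h1 (by omega)

theorem desc_comm_letter {k d j : ℕ} (hS : ∀ l, k ≤ l → l ≤ k + d → l ∈ S) (hj : j ∈ S)
    (hjk : j + 2 ≤ k) : desc t k d * t j = t j * desc t k d := by
  induction d with
  | zero => exact ht.comm _ hj _ (hS _ le_rfl le_rfl) hjk
  | succ d ih =>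
    rw [desc, mul_assoc, ih fun l h1 h2 => hS l h1 (by omega), ← mul_assoc, ← mul_assoc,
      ht.comm _ hj _ (hS _ (by omega) (by omega)) (by omega)]

theorem letter_comm_desc {k d j : ℕ} (hS : ∀ l, k ≤ l → l ≤ k + d → l ∈ S) (hj : j ∈ S)
    (hjk : k + d + 2 ≤ j) : desc t k d * t j = t j * desc t k d := by
  induction d with
  | zero => exact (ht.comm _ (hS _ le_rfl le_rfl) _ hj hjk).symm
  | succ d ih =>
    rw [desc, mul_assoc, ih (fun l h1 h2 => hS l h1 (by omega)) (by omega), ← mul_assoc,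
      ← mul_assoc, ht.comm _ (hS _ (by omega) (by omega)) _ hj (by omega)]

theorem desc_comm_desc {k d k' e : ℕ} (hS : ∀ l, k ≤ l → l ≤ k + d → l ∈ S)
    (hS' : ∀ l, k' ≤ l → l ≤ k' + e → l ∈ S) (h : k + d + 2 ≤ k') :
    desc t k' e * desc t k d = desc t k d * desc t k' e := by
  induction d with
  | zero => exact ht.desc_comm_letter hS' (hS _ le_rfl le_rfl) h
  | succ d ih =>
    rw [desc, ← mul_assoc, ht.desc_comm_letter hS' (hS _ (by omega) (by omega)) (by omega),
      mul_assoc, ih (fun l h1 h2 => hS l h1 (by omega)) (by omega), mul_assoc]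

/-- Multiplying a descending product by one of its inner letters on the right breaks it in two. -/
theorem desc_mul_inner {k d e : ℕ} (hS : ∀ l, k ≤ l → l ≤ k + d + 2 + e → l ∈ S) :
    desc t k (d + 2 + e) * t (k + d + 2) = desc t k d * desc t (k + d + 2) e := by
  have h1 : k + d + 1 ∈ S := hS _ (by omega) (by omega)
  have h2 : k + d + 2 ∈ S := hS _ (by omega) (by omega)
  have hd : ∀ l, k ≤ l → l ≤ k + d → l ∈ S := fun l h h' => hS l h (by omega)
  have he : ∀ l, k + d + 2 ≤ l → l ≤ k + d + 2 + e → l ∈ S := fun l h h' => hS l (by omega) h'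
  calc desc t k (d + 1 + 1 + e) * t (k + d + 2)
      = desc t (k + d + 2) e * t (k + d + 1) * (desc t k d * t (k + d + 2)) := by
        rw [desc_split, desc]; simp only [mul_assoc]; rfl
    _ = desc t (k + d + 2) e * t (k + d + 2) * t (k + d + 1) * t (k + d + 2) * desc t k d := by
        rw [ht.letter_comm_desc hd h2 (by omega), ht.desc_mul_letter h2]
        simp only [mul_assoc]
    _ = desc t (k + d + 2) e * (t (k + d + 2) * t (k + d + 1) * t (k + d + 2)) * desc t k d := by
        simp only [mul_assoc]
    _ = desc t (k + d + 2) e * desc t k d := by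
        rw [ht.down _ h1 h2, ht.desc_mul_letter h2]
    _ = _ := ht.desc_comm_desc hd he (by omega)

/-- Multiplying a descending product by one of its inner letters on the left breaks it in two. -/
theorem inner_mul_desc {k d e : ℕ} (hS : ∀ l, k ≤ l → l ≤ k + d + 2 + e → l ∈ S) :
    t (k + d) * desc t k (d + 2 + e) = desc t k d * desc t (k + d + 2) e := by
  have h0 : k + d ∈ S := hS _ (by omega) (by omega)
  have h1 : k + d + 1 ∈ S := hS _ (by omega) (by omega)
  have hd : ∀ l, k ≤ l → l ≤ k + d → l ∈ S := fun l h h' => hS l h (by omega)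
  have he : ∀ l, k + d + 2 ≤ l → l ≤ k + d + 2 + e → l ∈ S := fun l h h' => hS l (by omega) h'
  calc t (k + d) * desc t k (d + 1 + 1 + e)
      = t (k + d) * desc t (k + d + 2) e * t (k + d + 1) * desc t k d := by
        rw [desc_split, desc]; simp only [mul_assoc]; rfl
    _ = desc t (k + d + 2) e * t (k + d) * t (k + d + 1) * (t (k + d) * desc t k d) := by
        rw [ht.desc_comm_letter he h0 (by omega), ht.letter_mul_desc h0]
    _ = desc t (k + d + 2) e * (t (k + d) * t (k + d + 1) * t (k + d)) * desc t k d := by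
        simp only [mul_assoc]
    _ = desc t (k + d + 2) e * desc t k d := by
        rw [ht.up _ h0 h1, mul_assoc, ht.letter_mul_desc h0]
    _ = _ := ht.desc_comm_desc hd he (by omega)

/-- An element involving the letters up to `t m` either avoids `t m`, or can be written so that
`t m` occurs once, followed by a descending run of letters. -/
theorem below_succ {m : ℕ} {x : M} (hx : x ∈ below t S (m + 1)) :
    x ∈ below t S m ∨ ∃ k d, k + d = m ∧ (∀ l, k ≤ l → l ≤ k + d → l ∈ S) ∧
      ∃ y ∈ below t S m, x = y * desc t k d := by
  induction hx using Submonoid.closure_induction_right with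
  | one => exact Or.inl (one_mem _)
  | mul_right x _ a ha ih =>
    obtain ⟨i, ⟨hiS, him⟩, rfl⟩ := ha
    rcases ih with hx | ⟨k, d, rfl, hS, y, hy, rfl⟩
    · rcases Nat.lt_succ_iff_lt_or_eq.1 him with h | rfl
      · exact Or.inl (mul_mem hx (mem_below hiS h))
      · refine Or.inr ⟨i, 0, rfl, fun l h1 h2 => ?_, x, hx, rfl⟩
        obtain rfl : l = i := by omega
        exact hiS
    · right
      -- a letter far below the run passes it, one just below extends it, one inside cuts it
      by_cases h1 : i + 2 ≤ k
      · exact ⟨k, d, rfl, hS, y * t i, mul_mem hy (mem_below hiS (by omega)), by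
          rw [mul_assoc, ht.desc_comm_letter hS hiS h1, mul_assoc]⟩
      by_cases h2 : i + 1 = k
      · subst h2
        refine ⟨i, d + 1, by omega, fun l h h' => ?_, y, hy, ?_⟩
        · rcases h.eq_or_lt with rfl | h
          · exact hiS
          · exact hS l h (by omega)
        · rw [show d + 1 = 0 + 1 + d by omega, desc_split, mul_assoc]; rfl
      by_cases h3 : i = k
      · subst h3
        exact ⟨i, d, rfl, hS, y, hy, by rw [mul_assoc, ht.desc_mul_letter hiS]⟩
      by_cases h4 : i = k + 1
      · subst h4
        obtain ⟨e, rfl⟩ : ∃ e, d = 0 + 1 + e := ⟨d - 1, by omega⟩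
        refine ⟨k + 1, e, by omega, fun l h h' => hS l (by omega) (by omega), y, hy, ?_⟩
        rw [mul_assoc, desc_split]
        simp only [add_zero, desc]
        have hk : k ∈ S := hS _ le_rfl (by omega)
        rw [← ht.desc_mul_letter (d := e) hiS]
        simp only [mul_assoc]
        have := ht.down _ hk hiS
        rw [mul_assoc] at this
        rw [this]
      · obtain ⟨c, rfl⟩ : ∃ c, i = k + c + 2 := ⟨i - k - 2, by omega⟩
        obtain ⟨e, rfl⟩ : ∃ e, d = c + 2 + e := ⟨d - c - 2, by omega⟩
        refine ⟨k + c + 2, e, by omega, fun l h h' => hS l (by omega) (by omega),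
          y * desc t k c, mul_mem hy (desc_mem (fun l h h' => hS l h (by omega)) (by omega)), ?_⟩
        rw [mul_assoc, ht.desc_mul_inner fun l h h' => hS l h (by omega), mul_assoc]

/-- A homomorphism from a monoid with Jones generators is injective as soon as its values satisfy
three conditions: no element absorbs two consecutive letters, right multiplication by `t m` is
injective on the part generated by the earlier letters, and no element of that part absorbs
`t m`. -/
theorem injOn_below (f : M →* N)
    (no_two : ∀ k ∈ S, k + 1 ∈ S → ∀ x : N, x * f (t k) = x → x * f (t (k + 1)) = x → False)
    (cancel : ∀ m ∈ S, ∀ x ∈ below t S m, ∀ y ∈ below t S m,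
      f x * f (t m) = f y * f (t m) → f x = f y)
    (proper : ∀ m ∈ S, ∀ x ∈ below t S m, f x * f (t m) ≠ f x) (m : ℕ) :
    ∀ x ∈ below t S m, ∀ y ∈ below t S m, f x = f y → x = y := by
  induction m with
  | zero =>
    have h : ∀ x ∈ below t S 0, x = 1 := by
      intro x hx
      simpa [below] using hx
    intro x hx y hy _
    rw [h x hx, h y hy]
  | succ m ih =>
    -- cancellation of a descending product in the image
    have canc : ∀ k d, k + d = m → (∀ l, k ≤ l → l ≤ k + d → l ∈ S) →
        ∀ x ∈ below t S m, ∀ y ∈ below t S m, f (x * desc t k d) = f (y * desc t k d) →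
          x = y := by
      rintro k d rfl hS x hx y hy h
      refine ih x hx y hy (cancel _ (hS (k + d) (by omega) le_rfl) x hx y hy ?_)
      have := congrArg (· * f (asc t k d)) h
      simpa only [← map_mul, mul_assoc, ht.desc_mul_asc hS] using this
    -- an element avoiding `t m` against one involving it
    have mixed : ∀ x ∈ below t S m, ∀ k d, k + d = m → (∀ l, k ≤ l → l ≤ k + d → l ∈ S) →
        ∀ y ∈ below t S m, f x = f (y * desc t k d) → x = y * desc t k d := by
      rintro x hx k d rfl hS y hy h
      have hkS : k ∈ S := hS k le_rfl (by omega)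
      cases d with
      | zero =>
        have hxm : f x * f (t k) = f x := by
          rw [h, ← map_mul, mul_assoc, ht.desc_mul_letter hkS]
        exact absurd hxm (proper k hkS x hx)
      | succ d =>
        have hxk : x * t k = x := by
          refine ih _ (mul_mem hx (mem_below hkS (by omega))) x hx ?_
          rw [map_mul, h, ← map_mul, mul_assoc, ht.desc_mul_letter hkS]
        have hasc : asc t k d ∈ below t S (k + (d + 1)) :=
          asc_mem (fun l h1 h2 => hS l h1 (by omega)) (by omega)
        have hy' : x * asc t k d = y := by
          refine ih _ (mul_mem hx hasc) y hy (cancel (k + d + 1)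
            (hS _ (by omega) (by omega)) _ (mul_mem hx hasc) y hy ?_)
          have := congrArg (· * f (asc t k (d + 1))) h
          rw [← map_mul, ← map_mul, mul_assoc y, ht.desc_mul_asc hS] at this
          rw [← map_mul, ← map_mul, mul_assoc]
          exact this
        have htop : t (k + d + 1) * desc t k (d + 1) = desc t k (d + 1) :=
          ht.letter_mul_desc (d := d + 1) (hS _ (by omega) le_rfl)
        calc x = x * (t k * asc t k (d + 1) * desc t k (d + 1)) := by
              rw [ht.letter_mul_asc_mul_desc hS, hxk]
          _ = x * t k * asc t k d * (t (k + d + 1) * desc t k (d + 1)) := by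
              simp only [asc, mul_assoc]
          _ = _ := by rw [htop, hxk, hy']
    -- two elements involving `t m`
    have both : ∀ k d k' d', k ≤ k' → k + d = m → k' + d' = m →
        (∀ l, k ≤ l → l ≤ k + d → l ∈ S) →
        ∀ x ∈ below t S m, ∀ y ∈ below t S m, f (x * desc t k d) = f (y * desc t k' d') →
          x * desc t k d = y * desc t k' d' := by
      intro k d k' d' hkk hk hk' hS x hx y hy h
      have hS' : ∀ l, k' ≤ l → l ≤ k' + d' → l ∈ S := fun l h1 h2 => hS l (by omega) (by omega)
      have hkS : k ∈ S := hS k le_rfl (by omega)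
      have hkS' : k' ∈ S := hS' k' le_rfl (by omega)
      rcases hkk.eq_or_lt with rfl | hlt
      · obtain rfl : d = d' := by omega
        rw [canc k d hk hS x hx y hy h]
      have absk : f (x * desc t k d) * f (t k) = f (x * desc t k d) := by
        rw [← map_mul, mul_assoc, ht.desc_mul_letter hkS]
      have absk' : f (x * desc t k d) * f (t k') = f (x * desc t k d) := by
        rw [h, ← map_mul, mul_assoc, ht.desc_mul_letter hkS']
      by_cases h1 : k' = k + 1
      · subst h1
        exact (no_two k hkS hkS' _ absk absk').elim
      obtain ⟨c, rfl⟩ : ∃ c, k' = k + c + 2 := ⟨k' - k - 2, by omega⟩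
      obtain rfl : d = c + 2 + d' := by omega
      have hS'' : ∀ l, k ≤ l → l ≤ k + c + 2 + d' → l ∈ S := fun l h1 h2 => hS l h1 (by omega)
      have hc : k + c ∈ S := hS _ (by omega) (by omega)
      have hxc : x * t (k + c) = x := by
        refine canc k _ hk hS _ (mul_mem hx (mem_below hc (by omega))) x hx ?_
        rw [mul_assoc, ht.inner_mul_desc hS'', ← ht.desc_mul_inner hS'', ← mul_assoc, map_mul,
          absk']
      have key : x * desc t k (c + 2 + d') = x * desc t k c * desc t (k + c + 2) d' := by
        rw [mul_assoc, ← ht.inner_mul_desc hS'', ← mul_assoc, hxc]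
      rw [key] at h ⊢
      rw [canc _ _ hk' hS' _ (mul_mem hx (desc_mem (fun l h1 h2 => hS l h1 (by omega))
        (by omega))) y hy h]
    intro x hx y hy h
    rcases ht.below_succ hx with hx | ⟨k, d, hk, hS, x', hx', rfl⟩ <;>
      rcases ht.below_succ hy with hy | ⟨k', d', hk', hS', y', hy', rfl⟩
    · exact ih x hx y hy h
    · exact mixed x hx k' d' hk' hS' y' hy' h
    · exact (mixed y hy k d hk hS x' hx' h.symm).symm
    · rcases le_total k k' with hkk | hkk
      · exact both k d k' d' hkk hk hk' hS x' hx' y' hy' h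
      · exact (both k' d' k d hkk hk' hk hS' y' hy' x' hx' h.symm).symm

end JonesRel

end Jones

/-! ### Right multiplication by the generating partitions -/

theorem mul_rPtn_apply {n : ℕ} (J : Ptn n) (i : Fin n) (x y : Fin n ⊕ Fin n) :
    (J * rPtn i) x y ↔ x = y ∨ (J x y ∧ x ≠ Sum.inr i ∧ y ≠ Sum.inr i) := by
  rw [mul_def, concat_apply]
  constructor
  · let c : Fin n ⊕ Fin n ⊕ Fin n → Fin n ⊕ Fin n := Sum.map id (Sum.elim id id)
    let W : Setoid (Fin n ⊕ Fin n ⊕ Fin n) :=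
      ⟨fun u v => u = v ∨ (J (c u) (c v) ∧ u ≠ Sum.inr (Sum.inr i) ∧ v ≠ Sum.inr (Sum.inr i)), by
        refine ⟨fun _ => Or.inl rfl, ?_, ?_⟩
        · rintro u v (h | ⟨h, h1, h2⟩)
          · exact Or.inl h.symm
          · exact Or.inr ⟨J.symm' h, h2, h1⟩
        · rintro u v w (rfl | ⟨h, h1, h2⟩) (rfl | ⟨h', h3, h4⟩)
          · exact Or.inl rfl
          · exact Or.inr ⟨h', h3, h4⟩
          · exact Or.inr ⟨h, h1, h2⟩
          · exact Or.inr ⟨J.trans' h h', h1, h4⟩⟩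
    have key : stack J (rPtn i) ≤ W := by
      refine sup_le ((map_le_iff _ _ _).2 ?_) ((map_le_iff _ _ _).2 ?_)
      · rintro (x | x) (y | y) h <;> exact Or.inr ⟨h, by simp, by simp⟩
      · rintro x y (rfl | ⟨h, h'⟩)
        · exact Or.inl rfl
        · rcases x with x | x <;> rcases y with y | y <;> obtain rfl : x = y := h <;>
            refine Or.inr ⟨J.refl' _, ?_, ?_⟩ <;> simp_all [column]
    intro h
    rcases key h with h | ⟨h, h1, h2⟩
    · exact Or.inl (Function.Injective.sumMap Function.injective_id Sum.inr_injective h)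
    · refine Or.inr ⟨?_, ?_, ?_⟩
      · rcases x with x | x <;> rcases y with y | y <;> exact h
      · rintro rfl; exact h1 rfl
      · rintro rfl; exact h2 rfl
  · rintro (rfl | ⟨h, h1, h2⟩)
    · exact Setoid.refl' _ _
    · have coll : ∀ z : Fin n ⊕ Fin n, z ≠ Sum.inr i →
          stack J (rPtn i) (Sum.map id Sum.inr z) (Sum.map id Sum.inl z) := by
        rintro (z | z) hz
        · exact Setoid.refl' _ _
        · exact le_sup_right (a := Setoid.map _ _) (b := Setoid.map _ Sum.inr)
            (Relation.EqvGen.rel _ _ ⟨Sum.inr z, Sum.inl z,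
              Or.inr ⟨rfl, fun h => hz (congrArg Sum.inr h)⟩, rfl, rfl⟩)
      refine Setoid.trans' _ (coll x h1) (Setoid.trans' _ ?_ (Setoid.symm' _ (coll y h2)))
      exact le_sup_left (a := Setoid.map _ _) (b := Setoid.map _ _)
        (Relation.EqvGen.rel _ _ ⟨x, y, h, rfl, rfl⟩)

theorem mul_hPtn_apply {n : ℕ} (J : Ptn n) (i : Fin (n - 1)) (x y : Fin n ⊕ Fin n) :
    (J * hPtn i) x y ↔ J x y ∨ ((J x (Sum.inr (lo i)) ∨ J x (Sum.inr (hi i))) ∧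
      (J y (Sum.inr (lo i)) ∨ J y (Sum.inr (hi i)))) := by
  rw [mul_def, concat_apply]
  constructor
  · let c : Fin n ⊕ Fin n ⊕ Fin n → Fin n ⊕ Fin n := Sum.map id (Sum.elim id id)
    let V : Setoid (Fin n ⊕ Fin n) :=
      ⟨fun x y => J x y ∨ ((J x (Sum.inr (lo i)) ∨ J x (Sum.inr (hi i))) ∧
        (J y (Sum.inr (lo i)) ∨ J y (Sum.inr (hi i)))), by
        have s := @J.symm'
        have t := @J.trans'
        refine ⟨fun x => Or.inl (J.refl' x), ?_, ?_⟩
        · rintro x y (h | ⟨h, h'⟩)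
          · exact Or.inl (J.symm' h)
          · exact Or.inr ⟨h', h⟩
        · rintro x y z (h | ⟨h, h'⟩) (h1 | ⟨h1, h2⟩)
          · exact Or.inl (J.trans' h h1)
          · exact Or.inr ⟨h1.imp (t h) (t h), h2⟩
          · exact Or.inr ⟨h, h'.imp (t (s h1)) (t (s h1))⟩
          · exact Or.inr ⟨h, h2⟩⟩
    have key : stack J (hPtn i) ≤ V.comap c := by
      refine sup_le ((map_le_iff _ _ _).2 ?_) ((map_le_iff _ _ _).2 ?_)
      · rintro (x | x) (y | y) h <;> exact Or.inl h
      · have hc : ∀ x : Fin n ⊕ Fin n, c (Sum.inr x) = Sum.inr (column x) := by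
          rintro (x | x) <;> rfl
        rintro x y (h | ⟨h, h'⟩)
        · simp only [Setoid.comap_rel, hc, h]; exact V.refl' _
        · simp only [Setoid.comap_rel, hc]
          refine Or.inr ⟨?_, ?_⟩
          · rcases h with h | h <;> rw [h]
            exacts [Or.inl (J.refl' _), Or.inr (J.refl' _)]
          · rcases h' with h | h <;> rw [h]
            exacts [Or.inl (J.refl' _), Or.inr (J.refl' _)]
    intro h
    have := key h
    rcases x with x | x <;> rcases y with y | y <;> exact this
  · have up : ∀ x y, J x y → stack J (hPtn i) (Sum.map id Sum.inl x) (Sum.map id Sum.inl y) :=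
      fun x y h => le_sup_left (a := Setoid.map _ _) (b := Setoid.map _ _)
        (Relation.EqvGen.rel _ _ ⟨x, y, h, rfl, rfl⟩)
    have low : ∀ x y, hPtn i x y → stack J (hPtn i) (Sum.inr x) (Sum.inr y) :=
      fun x y h => le_sup_right (a := Setoid.map _ _) (b := Setoid.map _ _)
        (Relation.EqvGen.rel _ _ ⟨x, y, h, rfl, rfl⟩)
    have coll : ∀ z : Fin n ⊕ Fin n,
        stack J (hPtn i) (Sum.map id Sum.inr z) (Sum.map id Sum.inl z) := by
      rintro (z | z)
      · exact Setoid.refl' _ _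
      · exact low (Sum.inr z) (Sum.inl z) (Or.inl rfl)
    have toLo : ∀ x, (J x (Sum.inr (lo i)) ∨ J x (Sum.inr (hi i))) →
        stack J (hPtn i) (Sum.map id Sum.inl x) (Sum.inr (Sum.inl (lo i))) := by
      rintro x (h | h)
      · exact up _ _ h
      · exact Setoid.trans' _ (up _ _ h)
          (low (Sum.inl (hi i)) (Sum.inl (lo i)) (Or.inr ⟨Or.inr rfl, Or.inl rfl⟩))
    intro h
    refine Setoid.trans' _ (coll x) (Setoid.trans' _ ?_ (Setoid.symm' _ (coll y)))
    rcases h with h | ⟨h1, h2⟩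
    · exact up _ _ h
    · exact Setoid.trans' _ (toLo x h1) (Setoid.symm' _ (toLo y h2))

theorem rPtn_apply {n : ℕ} (i : Fin n) (x y : Fin n ⊕ Fin n) :
    rPtn i x y ↔ x = y ∨ (column x = column y ∧ column x ≠ i) := Iff.rfl

theorem hPtn_apply {n : ℕ} (i : Fin (n - 1)) (x y : Fin n ⊕ Fin n) :
    hPtn i x y ↔ column x = column y ∨
    ((column x = lo i ∨ column x = hi i) ∧ (column y = lo i ∨ column y = hi i)) := Iff.rfl

theorem lo_ne_hi {n : ℕ} (i : Fin (n - 1)) : lo i ≠ hi i := by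
  simp [lo, hi]

theorem mul_rPtn_eq_self {n : ℕ} {J : Ptn n} {i : Fin n} :
    J * rPtn i = J ↔ ∀ x, J x (Sum.inr i) → x = Sum.inr i := by
  constructor
  · intro h x hx
    rw [← h, mul_rPtn_apply] at hx
    simpa using hx
  · intro h
    ext x y
    rw [mul_rPtn_apply]
    refine ⟨?_, fun hxy => ?_⟩
    · rintro (rfl | h)
      exacts [J.refl' _, h.1]
    · by_cases hx : x = Sum.inr i
      · subst hx; exact Or.inl (h y (J.symm' hxy)).symm
      by_cases hy : y = Sum.inr i
      · subst hy; exact Or.inl (h x hxy)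
      exact Or.inr ⟨hxy, hx, hy⟩

theorem mul_hPtn_eq_self {n : ℕ} {J : Ptn n} {i : Fin (n - 1)} :
    J * hPtn i = J ↔ J (Sum.inr (lo i)) (Sum.inr (hi i)) := by
  constructor
  · intro h
    rw [← h, mul_hPtn_apply]
    exact Or.inr ⟨Or.inl (J.refl' _), Or.inr (J.refl' _)⟩
  · intro h
    ext x y
    rw [mul_hPtn_apply]
    have hl : ∀ z, (J z (Sum.inr (lo i)) ∨ J z (Sum.inr (hi i))) → J z (Sum.inr (lo i)) :=
      fun z hz => hz.elim id fun hz => J.trans' hz (J.symm' h)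
    exact ⟨fun h => h.elim id fun h => J.trans' (hl x h.1) (J.symm' (hl y h.2)), Or.inl⟩

/-! ### Relations between the generating partitions -/

theorem rPtn_mul_self {n : ℕ} (i : Fin n) : rPtn i * rPtn i = rPtn i := by
  rw [mul_rPtn_eq_self]
  rintro x (h | ⟨h, h'⟩)
  · exact h
  · exact absurd h h'

theorem hPtn_mul_self {n : ℕ} (i : Fin (n - 1)) : hPtn i * hPtn i = hPtn i := by
  rw [mul_hPtn_eq_self]
  exact Or.inr ⟨Or.inl rfl, Or.inr rfl⟩

theorem rPtn_comm {n : ℕ} (i j : Fin n) : rPtn i * rPtn j = rPtn j * rPtn i := by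
  ext (x | x) (y | y) <;> simp only [mul_rPtn_apply, rPtn_apply, column, Sum.elim_inl,
    Sum.elim_inr, id] <;> grind

theorem hPtn_comm {n : ℕ} (i j : Fin (n - 1)) : hPtn i * hPtn j = hPtn j * hPtn i := by
  ext x y
  simp only [mul_hPtn_apply, hPtn_apply]
  simp only [column, Sum.elim_inr, id]
  generalize Sum.elim id id x = a
  generalize Sum.elim id id y = b
  have := lo_ne_hi i
  have := lo_ne_hi j
  grind

theorem hPtn_rPtn_hPtn {n : ℕ} (i : Fin (n - 1)) (j : Fin n) (h : j = lo i ∨ j = hi i) :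
    hPtn i * rPtn j * hPtn i = hPtn i := by
  have := lo_ne_hi i
  ext (x | x) (y | y) <;> simp only [mul_rPtn_apply, mul_hPtn_apply, hPtn_apply, column,
    Sum.elim_inl, Sum.elim_inr, id] <;> grind

theorem hPtn_rPtn_comm {n : ℕ} (i : Fin (n - 1)) (j : Fin n) (h : j ≠ lo i ∧ j ≠ hi i) :
    hPtn i * rPtn j = rPtn j * hPtn i := by
  have := lo_ne_hi i
  ext (x | x) (y | y) <;> simp only [mul_rPtn_apply, mul_hPtn_apply, hPtn_apply, rPtn_apply,
    column, Sum.elim_inl, Sum.elim_inr, id] <;> grind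

theorem rPtn_hPtn_rPtn {n : ℕ} (i : Fin (n - 1)) (j : Fin n) (h : j = lo i ∨ j = hi i) :
    rPtn j * hPtn i * rPtn j = rPtn j := by
  have := lo_ne_hi i
  ext (x | x) (y | y) <;> simp only [mul_rPtn_apply, mul_hPtn_apply, rPtn_apply,
    column, Sum.elim_inl, Sum.elim_inr, id] <;> grind

/-! ### The generators as Jones letters -/

/-- The sequence `r_0, e_0, r_1, e_1, …, r_{n-1}`, continued by `1`. -/
def zigzag {n : ℕ} {X : Type*} [One X] (r : Fin n → X) (e : Fin (n - 1) → X) (l : ℕ) : X :=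
  if l % 2 = 0 then if h : l / 2 < n then r ⟨l / 2, h⟩ else 1
  else if h : l / 2 < n - 1 then e ⟨l / 2, h⟩ else 1

/-- The positions in the sequence `r_0, e_0, r_1, e_1, …, r_{n-1}` of the letters `r_i` with
`i ∈ A` and of all letters `e_i`. -/
def positions {n : ℕ} (A : Set (Fin n)) : Set ℕ :=
  {l | (∃ i ∈ A, l = 2 * (i : ℕ)) ∨ ∃ i : Fin (n - 1), l = 2 * (i : ℕ) + 1}

theorem zigzag_even {n : ℕ} {X : Type*} [One X] (r : Fin n → X) (e : Fin (n - 1) → X)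
    (i : Fin n) : zigzag r e (2 * (i : ℕ)) = r i := by
  simp [zigzag]

theorem zigzag_odd {n : ℕ} {X : Type*} [One X] (r : Fin n → X) (e : Fin (n - 1) → X)
    (i : Fin (n - 1)) : zigzag r e (2 * (i : ℕ) + 1) = e i := by
  have h1 : (2 * (i : ℕ) + 1) / 2 = i := by omega
  have h2 : (2 * (i : ℕ) + 1) % 2 ≠ 0 := by omega
  simp [zigzag, h1]

theorem map_zigzag {n : ℕ} {X Y : Type*} [Monoid X] [Monoid Y] (f : X →* Y) (r : Fin n → X)
    (e : Fin (n - 1) → X) (l : ℕ) :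
    f (zigzag r e l) = zigzag (fun i => f (r i)) (fun i => f (e i)) l := by
  unfold zigzag
  split_ifs <;> simp

theorem jonesRel_zigzag {n : ℕ} {X : Type*} [Monoid X] {A : Set (Fin n)} {r : Fin n → X}
    {e : Fin (n - 1) → X} (rr : ∀ i ∈ A, r i * r i = r i)
    (rc : ∀ i ∈ A, ∀ j ∈ A, r i * r j = r j * r i)
    (ee : ∀ i, e i * e i = e i) (ec : ∀ i j, e i * e j = e j * e i)
    (er : ∀ i, ∀ j ∈ A, j ≠ lo i ∧ j ≠ hi i → e i * r j = r j * e i)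
    (ere : ∀ i, ∀ j ∈ A, j = lo i ∨ j = hi i → e i * r j * e i = e i)
    (rer : ∀ i, ∀ j ∈ A, j = lo i ∨ j = hi i → r j * e i * r j = r j) :
    JonesRel (zigzag r e) (positions A) where
  idem := by
    rintro l (⟨i, hi, rfl⟩ | ⟨i, rfl⟩)
    · rw [zigzag_even]; exact rr i hi
    · rw [zigzag_odd]; exact ee i
  comm := by
    rintro k (⟨i, hi, rfl⟩ | ⟨i, rfl⟩) l (⟨j, hj, rfl⟩ | ⟨j, rfl⟩) h
    · rw [zigzag_even, zigzag_even]; exact rc j hj i hi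
    · rw [zigzag_even, zigzag_odd]
      refine er j i hi ⟨?_, ?_⟩ <;> rintro rfl <;> simp only [lo, PlanarRam.hi] at h <;> omega
    · rw [zigzag_even, zigzag_odd]
      refine (er i j hj ⟨?_, ?_⟩).symm <;> rintro rfl <;>
        simp only [lo, PlanarRam.hi] at h <;> omega
    · rw [zigzag_odd, zigzag_odd]; exact ec j i
  up := by
    rintro l (⟨i, hi, rfl⟩ | ⟨i, rfl⟩) (⟨j, hj, h⟩ | ⟨j, h⟩)
    · omega
    · rw [h, zigzag_even, zigzag_odd]
      exact rer j i hi (Or.inl (Fin.ext (by simp only [lo]; omega)))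
    · rw [h, zigzag_even, zigzag_odd]
      exact ere i j hj (Or.inr (Fin.ext (by simp only [PlanarRam.hi]; omega)))
    · omega
  down := by
    rintro l (⟨i, hi, rfl⟩ | ⟨i, rfl⟩) (⟨j, hj, h⟩ | ⟨j, h⟩)
    · omega
    · rw [h, zigzag_even, zigzag_odd]
      exact ere j i hi (Or.inl (Fin.ext (by simp only [lo]; omega)))
    · rw [h, zigzag_even, zigzag_odd]
      exact rer i j hj (Or.inr (Fin.ext (by simp only [PlanarRam.hi]; omega)))
    · omega

/-- The Jones letters `r_0, h_0, r_1, h_1, …, r_{n-1}` of the planar partition monoid. -/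
abbrev letter (n : ℕ) : ℕ → Ptn n := zigzag rPtn hPtn

theorem jonesRel_letter {n : ℕ} (A : Set (Fin n)) : JonesRel (letter n) (positions A) :=
  jonesRel_zigzag (fun i _ => rPtn_mul_self i) (fun i _ j _ => rPtn_comm i j) hPtn_mul_self
    hPtn_comm (fun i j _ h => hPtn_rPtn_comm i j h) (fun i j _ h => hPtn_rPtn_hPtn i j h)
    (fun i j _ h => rPtn_hPtn_rPtn i j h)

/-! ### Partitions generated by an initial segment of the letters -/

/-- All columns far enough to the right are straight. For `m = 2i` the columns after `i` are blocks
and `i`, `i'` are joined; for `m = 2i + 1` only the columns after `i` are required to be blocks. In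
terms of the `2n` boundary strands of the blocks, those after the first `m + 1` go straight down. -/
def Supp {n : ℕ} (m : ℕ) (J : Ptn n) : Prop :=
  (∀ c : Fin n, m ≤ 2 * (c : ℕ) → J (Sum.inl c) (Sum.inr c)) ∧
    ∀ c : Fin n, m < 2 * (c : ℕ) → ∀ x, J x (Sum.inr c) → column x = c

theorem Supp.mul_mem_below {n : ℕ} {A : Set (Fin n)} {m : ℕ} {J K : Ptn n} (hJ : Supp m J)
    (hK : K ∈ below (letter n) (positions A) m) : Supp m (J * K) := by
  induction hK using Submonoid.closure_induction_right with
  | one => rwa [mul_one]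
  | mul_right K _ a ha ih =>
    obtain ⟨l, ⟨⟨i, -, rfl⟩ | ⟨i, rfl⟩, hlm⟩, rfl⟩ := ha
    · rw [← mul_assoc, letter, zigzag_even]
      refine ⟨fun c hc => ?_, fun c hc x hx => ?_⟩
      · refine (mul_rPtn_apply (J * K) i _ _).2 (Or.inr ⟨ih.1 c hc, by simp, fun h => ?_⟩)
        obtain rfl := Sum.inr_injective h
        omega
      · rcases (mul_rPtn_apply (J * K) i _ _).1 hx with rfl | hx
        exacts [rfl, ih.2 c hc x hx.1]
    · rw [← mul_assoc, letter, zigzag_odd]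
      refine ⟨fun c hc => ?_, fun c hc x hx => ?_⟩
      · exact (mul_hPtn_apply (J * K) i _ _).2 (Or.inl (ih.1 c hc))
      · rcases (mul_hPtn_apply (J * K) i _ _).1 hx with hx | ⟨-, hx | hx⟩
        · exact ih.2 c hc x hx
        · have := ih.2 c hc _ (Setoid.symm' _ hx)
          rw [← this] at hc
          simp only [column, Sum.elim_inr, id, lo] at hc
          omega
        · have := ih.2 c hc _ (Setoid.symm' _ hx)
          rw [← this] at hc
          simp only [column, Sum.elim_inr, id, hi] at hc
          omega

theorem supp_of_mem_below {n : ℕ} {A : Set (Fin n)} {m : ℕ} {J : Ptn n}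
    (hJ : J ∈ below (letter n) (positions A) m) : Supp m J := by
  have h1 : Supp m (1 : Ptn n) := ⟨fun c _ => rfl, fun c _ x hx => hx⟩
  simpa using h1.mul_mem_below hJ

theorem letter_not_absorbed_two {n : ℕ} {A : Set (Fin n)} {k : ℕ} (hk : k ∈ positions A)
    (hk' : k + 1 ∈ positions A) {J : Ptn n} (h : J * letter n k = J)
    (h' : J * letter n (k + 1) = J) : False := by
  rcases hk with ⟨i, -, rfl⟩ | ⟨i, rfl⟩ <;> rcases hk' with ⟨j, -, hj⟩ | ⟨j, hj⟩
  · omega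
  · rw [letter, hj, zigzag_odd, mul_hPtn_eq_self] at h'
    rw [letter, zigzag_even, mul_rPtn_eq_self] at h
    obtain rfl : i = lo j := Fin.ext (by simp only [lo]; omega)
    exact lo_ne_hi j (Sum.inr_injective (h _ (J.symm' h'))).symm
  · rw [letter, hj, zigzag_even, mul_rPtn_eq_self] at h'
    rw [letter, zigzag_odd, mul_hPtn_eq_self] at h
    obtain rfl : j = hi i := Fin.ext (by simp only [hi]; omega)
    exact lo_ne_hi i (Sum.inr_injective (h' _ h))
  · omega

theorem Supp.mul_letter_ne {n : ℕ} {A : Set (Fin n)} {m : ℕ} (hm : m ∈ positions A) {J : Ptn n}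
    (hJ : Supp m J) : J * letter n m ≠ J := by
  intro h
  rcases hm with ⟨i, -, rfl⟩ | ⟨i, rfl⟩
  · rw [letter, zigzag_even, mul_rPtn_eq_self] at h
    exact absurd (h _ (hJ.1 i le_rfl)) (by simp)
  · rw [letter, zigzag_odd, mul_hPtn_eq_self] at h
    exact lo_ne_hi i (hJ.2 (hi i) (by simp only [hi]; omega) _ h)

theorem Supp.mul_rPtn_cancel {n : ℕ} {i : Fin n} {J K : Ptn n} (hJ : Supp (2 * i) J)
    (hK : Supp (2 * i) K) (h : J * rPtn i = K * rPtn i) : J = K := by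
  -- the point `i'` lies in the block of `i`, which survives the multiplication
  have key : ∀ {J : Ptn n}, Supp (2 * (i : ℕ)) J → ∀ x y, J x y ↔
      (J * rPtn i) (if x = Sum.inr i then Sum.inl i else x)
        (if y = Sum.inr i then Sum.inl i else y) := by
    intro J hJ x y
    have h0 := hJ.1 i le_rfl
    have h1 : ∀ z, J z (if z = Sum.inr i then Sum.inl i else z) := by
      intro z
      split_ifs with hz
      · exact hz ▸ J.symm' h0
      · exact J.refl' z
    have h2 : ∀ z, (if z = Sum.inr i then Sum.inl i else z : Fin n ⊕ Fin n) ≠ Sum.inr i := by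
      intro z
      split_ifs with hz
      · simp
      · exact hz
    rw [mul_rPtn_apply]
    constructor
    · intro h
      exact Or.inr ⟨J.trans' (J.symm' (h1 x)) (J.trans' h (h1 y)), h2 x, h2 y⟩
    · rintro (h | ⟨h, -⟩)
      · exact J.trans' (h1 x) (h ▸ J.symm' (h1 y))
      · exact J.trans' (h1 x) (J.trans' h (J.symm' (h1 y)))
  ext x y
  rw [key hJ, key hK, h]

theorem Supp.mul_hPtn_cancel {n : ℕ} {i : Fin (n - 1)} {J K : Ptn n} (hJ : Supp (2 * i + 1) J)
    (hK : Supp (2 * i + 1) K) (h : J * hPtn i = K * hPtn i) : J = K := by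
  -- column `i + 1` is a block by itself, and outside of it the multiplication changes nothing
  have key : ∀ {J : Ptn n}, Supp (2 * (i : ℕ) + 1) J → ∀ x y, J x y ↔
      (J * hPtn i) x y ∧ (column x = hi i ↔ column y = hi i) := by
    intro J hJ x y
    have h0 : J (Sum.inl (hi i)) (Sum.inr (hi i)) := hJ.1 _ (by simp only [hi]; omega)
    have h1 : ∀ z, J z (Sum.inr (hi i)) ↔ column z = hi i := by
      intro z
      refine ⟨hJ.2 (hi i) (by simp only [hi]; omega) z, fun hz => ?_⟩
      rcases z with z | z <;> obtain rfl : z = hi i := hz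
      exacts [h0, J.refl' _]
    rw [mul_hPtn_apply, ← h1, ← h1]
    constructor
    · intro h
      exact ⟨Or.inl h, fun h' => J.trans' (J.symm' h) h', fun h' => J.trans' h h'⟩
    · rintro ⟨h | ⟨h, h'⟩, h2⟩
      · exact h
      · by_cases hx : J x (Sum.inr (hi i))
        · exact J.trans' hx (J.symm' (h2.1 hx))
        · exact J.trans' (h.resolve_right hx)
            (J.symm' (h'.resolve_right fun hy => hx (h2.2 hy)))
  ext x y
  rw [key hJ, key hK, h]

theorem Supp.mul_letter_cancel {n : ℕ} {A : Set (Fin n)} {m : ℕ} (hm : m ∈ positions A)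
    {J K : Ptn n} (hJ : Supp m J) (hK : Supp m K) (h : J * letter n m = K * letter n m) :
    J = K := by
  rcases hm with ⟨i, -, rfl⟩ | ⟨i, rfl⟩
  · rw [letter, zigzag_even] at h
    exact hJ.mul_rPtn_cancel hK h
  · rw [letter, zigzag_odd] at h
    exact hJ.mul_hPtn_cancel hK h

theorem injOn_below_of_letter {M : Type*} [Monoid M] {n : ℕ} {A : Set (Fin n)} {t : ℕ → M}
    (ht : JonesRel t (positions A)) (f : M →* Ptn n) (hf : ∀ l, f (t l) = letter n l) (m : ℕ) :
    ∀ x ∈ below t (positions A) m, ∀ y ∈ below t (positions A) m, f x = f y → x = y := by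
  have hs : ∀ m, ∀ x ∈ below t (positions A) m, Supp m (f x) := by
    intro m x hx
    refine supp_of_mem_below (A := A) ?_
    have := Submonoid.mem_map_of_mem f hx
    rwa [below, MonoidHom.map_mclosure, Set.image_image, Set.image_congr fun l _ => hf l] at this
  refine ht.injOn_below f ?_ ?_ ?_ m
  · intro k hk hk' J h h'
    rw [hf] at h h'
    exact letter_not_absorbed_two hk hk' h h'
  · intro m hm x hx y hy h
    rw [hf] at h
    exact Supp.mul_letter_cancel hm (hs m x hx) (hs m y hy) h
  · intro m hm x hx
    rw [hf]
    exact Supp.mul_letter_ne hm (hs m x hx)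

/-! ### Planar partitions are products of letters -/

theorem isPlanar_rPtn {n : ℕ} (i : Fin n) : IsPlanar (rPtn i) := by
  intro a b c d hab hbc hcd hac hbd
  have h1 := isPlanar_one n a b c d hab hbc hcd
  simp only [one_apply, rPtn_apply, column] at *
  rcases hac with rfl | hac
  · omega
  rcases hbd with rfl | hbd
  · omega
  exact Or.inr ⟨h1 hac.1 hbd.1, hac.2⟩

theorem isPlanar_hPtn {n : ℕ} (i : Fin (n - 1)) : IsPlanar (hPtn i) := by
  intro a b c d hab hbc hcd hac hbd
  rw [hPtn_apply] at *
  simp only [lo, hi, Fin.ext_iff] at *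
  rcases a with a | a <;> rcases b with b | b <;> rcases c with c | c <;> rcases d with d | d <;>
    simp only [pos, column, Sum.elim_inl, Sum.elim_inr, id] at * <;> omega

/-- The right-hand one of the two boundary strands on which the letter `m` acts, followed from its
lower end, leads to the left. For even `m = 2i` this is the strand on the right of the point `i'`,
for odd `m = 2i + 1` it is the strand on the left of `(i + 1)'`. -/
def LeftBound {n : ℕ} (J : Ptn n) (m : ℕ) : Prop :=
  (∃ i : Fin n, m = 2 * i ∧ ¬ J (Sum.inl i) (Sum.inr i) ∧
    ∀ x, J x (Sum.inr i) → column x ≤ i) ∨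
  ∃ i : Fin (n - 1), m = 2 * i + 1 ∧ ∃ x, J x (Sum.inr (hi i)) ∧ column x ≤ lo i

/-- If all strands after those of the letter `m` are straight, but the right-hand strand of the
letter `m` is not, then there is only room on its left. -/
theorem Supp.leftBound {n m : ℕ} {J : Ptn n} (hJ : Supp (m + 1) J) (hJ' : ¬ Supp m J) :
    LeftBound J m := by
  obtain ⟨i, rfl | rfl⟩ := Nat.even_or_odd' m
  · by_cases hi : ∃ c : Fin n, (c : ℕ) = i ∧ ¬ J (Sum.inl c) (Sum.inr c)
    · obtain ⟨c, rfl, hc⟩ := hi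
      refine Or.inl ⟨c, rfl, hc, fun x hx => ?_⟩
      by_contra hlt
      rw [not_le] at hlt
      have hlt' : (c : ℕ) < column x := hlt
      have hx' : J (Sum.inr (column x)) x := by
        rcases x with x | x
        · exact J.symm' (hJ.1 x (by simp only [column, Sum.elim_inl, id] at hlt'; omega))
        · exact J.refl' _
      have := hJ.2 (column x) (by omega) (Sum.inr c) (J.symm' (J.trans' hx' hx))
      simp only [column, Sum.elim_inr, id] at this hlt'
      omega
    · push Not at hi
      refine absurd ⟨fun c hc => ?_, fun c hc => hJ.2 c (by omega)⟩ hJ'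
      rcases hc.eq_or_lt with h | h
      · exact hi c (by omega)
      · exact hJ.1 c (by omega)
  · by_cases hi' : ∃ c : Fin n, (c : ℕ) = i + 1 ∧ ∃ x, J x (Sum.inr c) ∧ column x ≠ c
    · obtain ⟨c, hc, x, hx, hxc⟩ := hi'
      have hin : i < n - 1 := by omega
      obtain rfl : c = hi ⟨i, hin⟩ := Fin.ext hc
      refine Or.inr ⟨⟨i, hin⟩, rfl, x, hx, ?_⟩
      by_contra hlt
      have hlt' : i + 1 < column x := by
        have h1 : ¬ ((column x : ℕ) ≤ i) := hlt
        have h2 : ¬ ((column x : ℕ) = i + 1) := fun h => hxc (Fin.ext h)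
        omega
      have hx' : J (Sum.inr (column x)) x := by
        rcases x with x | x
        · exact J.symm' (hJ.1 x (by simp only [column, Sum.elim_inl, id] at hlt'; omega))
        · exact J.refl' _
      have := hJ.2 (column x) (by omega) _ (J.symm' (J.trans' hx' hx))
      exact hxc this.symm
    · push Not at hi'
      refine absurd ⟨fun c hc => hJ.1 c (by omega), fun c hc => ?_⟩ hJ'
      by_cases h : (c : ℕ) = i + 1
      · exact hi' c h
      · exact hJ.2 c (by omega)

/-- A strand leading to the left either turns around at once, in which case the corresponding
letter is absorbed, or it encloses its left neighbour, which then leads to the left as well. -/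
theorem LeftBound.step {n m : ℕ} {J : Ptn n} (hp : IsPlanar J) (h : LeftBound J m) :
    J * letter n m = J ∨ ∃ k, m = k + 1 ∧ LeftBound J k := by
  rcases h with ⟨i, rfl, hi, hx⟩ | ⟨i, rfl, x, hx, hxi⟩
  · rw [letter, zigzag_even, mul_rPtn_eq_self]
    by_cases hs : ∀ x, J x (Sum.inr i) → x = Sum.inr i
    · exact Or.inl hs
    right
    push Not at hs
    obtain ⟨x, hxJ, hxi⟩ := hs
    have hlt : column x < i := by
      refine lt_of_le_of_ne (hx x hxJ) fun h => ?_
      rcases x with x | x <;> obtain rfl : x = i := h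
      exacts [hi hxJ, hxi rfl]
    have hlt' : (column x : ℕ) < i := hlt
    obtain ⟨j, hj⟩ : ∃ j : ℕ, (i : ℕ) = j + 1 := ⟨i - 1, by omega⟩
    have hjn : j < n - 1 := by omega
    obtain rfl : i = PlanarRam.hi ⟨j, hjn⟩ := Fin.ext hj
    exact ⟨2 * j + 1, by simp only [PlanarRam.hi]; omega, Or.inr ⟨⟨j, hjn⟩, rfl, x, hxJ,
      Nat.lt_succ_iff.1 hlt'⟩⟩
  · rw [letter, zigzag_odd, mul_hPtn_eq_self]
    by_cases hc : J (Sum.inr (lo i)) (Sum.inr (hi i))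
    · exact Or.inl hc
    right
    have hc' : ¬ J (Sum.inr (hi i)) (Sum.inr (lo i)) := fun h => hc (J.symm' h)
    have hxl : ¬ J x (Sum.inr (lo i)) := fun h => hc (J.trans' (J.symm' h) hx)
    have hlo : (lo i : ℕ) = i := rfl
    have hhi : (hi i : ℕ) = i + 1 := rfl
    have hxi' : (column x : ℕ) ≤ i := hxi
    have hxne : x ≠ Sum.inr (lo i) := fun h => hc (h ▸ hx)
    have hpx : (pos x < pos (Sum.inl (lo i) : Fin n ⊕ Fin n) ∨ x = Sum.inl (lo i)) ∨
        pos (Sum.inr (lo i) : Fin n ⊕ Fin n) < pos x := by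
      rcases x with x | x <;>
        simp only [pos, column, Sum.elim_inl, Sum.elim_inr, id, ne_eq, Sum.inr.injEq,
          Sum.inl.injEq, Fin.ext_iff, reduceCtorEq, hlo] at * <;> omega
    refine ⟨2 * i, rfl, Or.inl ⟨lo i, by rw [hlo], fun h => ?_, fun y hy => ?_⟩⟩
    · -- the vertical line in column `i` would separate `x` from `(i + 1)'`
      rcases hpx with (hpx | rfl) | hpx
      · refine hxl (J.trans' (hp x (Sum.inl (lo i)) (Sum.inr (hi i)) (Sum.inr (lo i)) hpx ?_ ?_
          hx h) h) <;> simp only [pos, Sum.elim_inl, Sum.elim_inr] <;> omega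
      · exact hxl h
      · refine hxl (J.trans' (J.symm' (J.trans' (hp (Sum.inl (lo i)) (Sum.inr (hi i))
          (Sum.inr (lo i)) x ?_ ?_ hpx h (J.symm' hx)) (J.symm' hx))) h) <;>
          simp only [pos, Sum.elim_inl, Sum.elim_inr] <;> omega
    · by_contra hlt
      have hyi : ¬ (column y : ℕ) ≤ i := hlt
      have hyh : ¬ J y (Sum.inr (hi i)) := fun h => hc' (J.trans' (J.symm' h) hy)
      have hpy : pos (Sum.inl (lo i) : Fin n ⊕ Fin n) < pos y ∧
          pos y < pos (Sum.inr (hi i) : Fin n ⊕ Fin n) := by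
        have hne : y ≠ Sum.inr (hi i) := fun h => hyh (h ▸ J.refl' _)
        have := (column y).isLt
        rcases y with y | y <;>
          simp only [pos, column, Sum.elim_inl, Sum.elim_inr, id, ne_eq, Sum.inr.injEq,
            Fin.ext_iff, reduceCtorEq, hlo, hhi] at * <;> omega
      rcases hpx with hpx | hpx
      · have hpx' : pos x < pos y := by
          rcases hpx with hpx | rfl
          exacts [hpx.trans hpy.1, hpy.1]
        refine hxl (J.trans' (hp x y (Sum.inr (hi i)) (Sum.inr (lo i)) hpx' hpy.2 ?_ hx hy) hy)
        simp only [pos, Sum.elim_inr]; omega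
      · refine hyh (hp y (Sum.inr (hi i)) (Sum.inr (lo i)) x hpy.2 ?_ hpx hy (J.symm' hx))
        simp only [pos, Sum.elim_inr]; omega

/-- A strand leading to the left encloses one that turns around at once. The letters from there up
to `m` are all available: a straight column in between would block the strand. -/
theorem LeftBound.exists_absorbed {n : ℕ} {A : Set (Fin n)} {J : Ptn n} (hp : IsPlanar J)
    (hA : ∀ c ∉ A, J (Sum.inl c) (Sum.inr c)) {m : ℕ} (h : LeftBound J m) :
    ∃ k d, k + d = m ∧ (∀ l, k ≤ l → l ≤ k + d → l ∈ positions A) ∧ J * letter n k = J := by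
  have hS : ∀ {m}, LeftBound J m → m ∈ positions A := by
    rintro m (⟨i, rfl, hi, -⟩ | ⟨i, rfl, -⟩)
    · exact Or.inl ⟨i, by_contra fun hiA => hi (hA i hiA), rfl⟩
    · exact Or.inr ⟨i, rfl⟩
  induction m with
  | zero =>
    rcases h.step hp with h' | ⟨k, hk, -⟩
    · exact ⟨0, 0, rfl, fun l h1 h2 => by obtain rfl : l = 0 := by omega
                                          exact hS h, h'⟩
    · omega
  | succ m ih =>
    rcases h.step hp with h' | ⟨k, hk, h'⟩
    · refine ⟨m + 1, 0, rfl, fun l h1 h2 => ?_, h'⟩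
      obtain rfl : l = m + 1 := by omega
      exact hS h
    · obtain rfl : m = k := by omega
      obtain ⟨k, d, rfl, h1, h2⟩ := ih h'
      refine ⟨k, d + 1, rfl, fun l h3 h4 => ?_, h2⟩
      rcases h4.eq_or_lt with rfl | h4
      · exact hS h
      · exact h1 l h3 (by omega)

/-- If `i'` is a singleton and the columns after `i` are straight, then `J = K * r_i`, where
`K` arises from `J` by adding `i'` to the block of `i`. -/
theorem exists_eq_mul_rPtn {n : ℕ} {i : Fin n} {J : Ptn n} (hp : IsPlanar J)
    (hJ : Supp (2 * i + 1) J) (h : J * rPtn i = J) :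
    ∃ K : Ptn n, IsPlanar K ∧ Supp (2 * i) K ∧
      (∀ c, J (Sum.inl c) (Sum.inr c) → K (Sum.inl c) (Sum.inr c)) ∧ J = K * rPtn i := by
  rw [mul_rPtn_eq_self] at h
  let p : Fin n ⊕ Fin n → Fin n ⊕ Fin n := fun x => if x = Sum.inr i then Sum.inl i else x
  have pi : p (Sum.inr i) = Sum.inl i := if_pos rfl
  have pn : ∀ {x}, x ≠ Sum.inr i → p x = x := fun hx => if_neg hx
  have pl : ∀ c, p (Sum.inl c) = Sum.inl c := fun c => pn (by simp)
  -- a column after `i` is a block, so it cannot separate `i` from `i'`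
  have triv : ∀ x y, J x y → i < column x → column y = column x := by
    intro x y hxy hx
    have hx' : (i : ℕ) < column x := hx
    have h1 : J x (Sum.inr (column x)) := by
      rcases x with x | x
      · exact hJ.1 x (by simp only [column, Sum.elim_inl, id] at hx'; omega)
      · exact J.refl' _
    exact hJ.2 (column x) (by omega) y (J.trans' (J.symm' hxy) h1)
  have hpos : ∀ x : Fin n ⊕ Fin n, x ≠ Sum.inr i → x = Sum.inl i ∨ i < column x ∨
      pos x < pos (Sum.inl i : Fin n ⊕ Fin n) ∨ pos (Sum.inr i : Fin n ⊕ Fin n) < pos x := by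
    rintro (x | x) hx <;>
      simp only [pos, column, Sum.elim_inl, Sum.elim_inr, id, ne_eq, Sum.inr.injEq, Sum.inl.injEq,
        reduceCtorEq, Fin.ext_iff, Fin.lt_def] at * <;> omega
  have hcol : ∀ x y : Fin n ⊕ Fin n, i < column x → column y = column x →
      pos (Sum.inl i : Fin n ⊕ Fin n) < pos y ∧ pos y < pos (Sum.inr i : Fin n ⊕ Fin n) := by
    intro x y hx hy
    rw [← hy] at hx
    have := (column y).isLt
    rcases y with y | y <;>
      simp only [pos, column, Sum.elim_inl, Sum.elim_inr, id, Fin.lt_def] at * <;> omega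
  have hii : pos (Sum.inl i : Fin n ⊕ Fin n) < pos (Sum.inr i : Fin n ⊕ Fin n) := by
    simp only [pos, Sum.elim_inl, Sum.elim_inr]; omega
  refine ⟨J.comap p, ?_, ⟨fun c hc => ?_, fun c hc x hx => ?_⟩, fun c hc => ?_, ?_⟩
  · intro a b c d hab hbc hcd hac hbd
    rw [Setoid.comap_rel] at *
    by_cases ha : a = Sum.inr i
    · subst ha
      have hb : b ≠ Sum.inr i := by rintro rfl; exact lt_irrefl _ hab
      have hc : c ≠ Sum.inr i := by rintro rfl; omega
      have hd : d ≠ Sum.inr i := by rintro rfl; omega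
      rw [pi, pn hc] at hac
      rw [pn hb, pn hd] at hbd
      rw [pi, pn hb]
      exact hp _ b c d (hii.trans hab) hbc hcd hac hbd
    by_cases hb : b = Sum.inr i
    · subst hb
      have hc : c ≠ Sum.inr i := by rintro rfl; omega
      have hd : d ≠ Sum.inr i := by rintro rfl; omega
      rw [pn ha, pn hc] at hac
      rw [pi, pn hd] at hbd
      rw [pi, pn ha]
      rcases hpos a ha with rfl | h1 | h1 | h1
      · exact J.refl' _
      · have := hcol a c h1 (triv a c hac h1); omega
      · exact hp a _ c d h1 (hii.trans hbc) hcd hac hbd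
      · omega
    by_cases hc : c = Sum.inr i
    · subst hc
      have hd : d ≠ Sum.inr i := by rintro rfl; omega
      rw [pi, pn ha] at hac
      rw [pn hb, pn hd] at hbd
      rw [pn hb, pn ha]
      rcases hpos b hb with rfl | h1 | h1 | h1
      · exact hac
      · have := hcol b d h1 (triv b d hbd h1); omega
      · exact hp a b _ d hab h1 (hii.trans hcd) hac hbd
      · omega
    rw [pn ha, pn hc] at hac
    rw [pn ha, pn hb]
    by_cases hd : d = Sum.inr i
    · subst hd
      rw [pi, pn hb] at hbd
      rcases hpos c hc with rfl | h1 | h1 | h1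
      · exact J.trans' hac (J.symm' hbd)
      · have := hcol c a h1 (triv c a (J.symm' hac) h1)
        have := hcol c c h1 rfl
        by_cases hbi : i < column b
        · have := triv b _ hbd hbi
          simp only [column, Sum.elim_inl, id] at this
          simp only [column, ← this] at hbi
          exact absurd hbi (lt_irrefl _)
        · rcases hpos b hb with rfl | h2 | h2 | h2
          · omega
          · exact absurd h2 hbi
          · omega
          · omega
      · exact hp a b c _ hab hbc h1 hac hbd
      · omega
    · rw [pn hb, pn hd] at hbd
      exact hp a b c d hab hbc hcd hac hbd
  · rw [Setoid.comap_rel, pl]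
    by_cases hci : c = i
    · subst hci; rw [pi]
    · rw [pn (by simpa using hci)]
      have : (c : ℕ) ≠ i := fun h => hci (Fin.ext h)
      exact hJ.1 c (by omega)
  · have hci : c ≠ i := by rintro rfl; omega
    rw [Setoid.comap_rel, pn (x := Sum.inr c) (by simpa using hci)] at hx
    have hc' := hJ.2 c (by omega) _ hx
    by_cases hxi : x = Sum.inr i
    · subst hxi; rwa [pi] at hc'
    · rwa [pn hxi] at hc'
  · rw [Setoid.comap_rel, pl]
    by_cases hci : c = i
    · subst hci; rw [pi]
    · rwa [pn (by simpa using hci)]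
  · ext x y
    refine Iff.trans ?_ (mul_rPtn_apply (J.comap p) i x y).symm
    constructor
    · intro hxy
      by_cases hx : x = Sum.inr i
      · subst hx; exact Or.inl (h y (J.symm' hxy)).symm
      by_cases hy : y = Sum.inr i
      · subst hy; exact Or.inl (h x hxy)
      exact Or.inr ⟨show J (p x) (p y) by rwa [pn hx, pn hy], hx, hy⟩
    · rintro (rfl | ⟨hxy, hx, hy⟩)
      · exact J.refl' _
      · have hxy : J (p x) (p y) := hxy
        rwa [pn hx, pn hy] at hxy

/-- If `i'` and `(i + 1)'` are joined, `i + 1` and `(i + 1)'` are joined, and the later columns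
are straight, then `J = K * h_i`, where `K` arises from `J` by splitting off column `i + 1`. -/
theorem exists_eq_mul_hPtn {n : ℕ} {i : Fin (n - 1)} {J : Ptn n} (hp : IsPlanar J)
    (hJ : Supp (2 * i + 2) J) (h : J * hPtn i = J) :
    ∃ K : Ptn n, IsPlanar K ∧ Supp (2 * i + 1) K ∧
      (∀ c, J (Sum.inl c) (Sum.inr c) → K (Sum.inl c) (Sum.inr c)) ∧ J = K * hPtn i := by
  rw [mul_hPtn_eq_self] at h
  have hhi : (hi i : ℕ) = i + 1 := rfl
  have hcolJ : ∀ x, column x = hi i → J x (Sum.inr (hi i)) := by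
    rintro (x | x) hx <;> obtain rfl : x = hi i := hx
    exacts [hJ.1 _ (by omega), J.refl' _]
  have triv : ∀ x y, J x y → hi i < column x → column y = column x := by
    intro x y hxy hx
    have hx' : (i : ℕ) + 1 < column x := hx
    have h1 : J x (Sum.inr (column x)) := by
      rcases x with x | x
      · exact hJ.1 x (by simp only [column, Sum.elim_inl, id] at hx'; omega)
      · exact J.refl' _
    exact hJ.2 (column x) (by omega) y (J.trans' (J.symm' hxy) h1)
  let K : Ptn n := J ⊓ Setoid.comap column
    ⟨fun a b => a = hi i ↔ b = hi i, fun _ => Iff.rfl, fun h => h.symm, fun h h' => h.trans h'⟩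
  have hK : ∀ x y, K x y ↔ J x y ∧ (column x = hi i ↔ column y = hi i) := fun x y => Iff.rfl
  refine ⟨K, ?_, ⟨fun c hc => ?_, fun c hc x hx => ?_⟩, fun c hc => ?_, ?_⟩
  · intro a b c d hab hbc hcd hac hbd
    rw [hK] at *
    refine ⟨hp a b c d hab hbc hcd hac.1 hbd.1, ?_⟩
    have tb := triv b d hbd.1
    have tc := triv c a (J.symm' hac.1)
    have h1 := hac.2
    have h2 := hbd.2
    simp only [Fin.lt_def, Fin.ext_iff, hhi] at tb tc h1 h2 ⊢
    rcases a with a | a <;> rcases b with b | b <;> rcases c with c | c <;> rcases d with d | d <;>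
      simp only [pos, column, Sum.elim_inl, Sum.elim_inr, id] at * <;> omega
  · rw [hK]
    exact ⟨hJ.1 c (by omega), Iff.rfl⟩
  · rw [hK] at hx
    rcases (show (i : ℕ) + 1 ≤ c by omega).eq_or_lt with h1 | h1
    · obtain rfl : c = hi i := Fin.ext h1.symm
      exact hx.2.2 rfl
    · exact hJ.2 c (by omega) x hx.1
  · exact ⟨hc, Iff.rfl⟩
  · ext x y
    rw [mul_hPtn_apply]
    simp only [hK]
    have hl : column (Sum.inr (lo i) : Fin n ⊕ Fin n) ≠ hi i := lo_ne_hi i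
    have hh : column (Sum.inr (hi i) : Fin n ⊕ Fin n) = hi i := rfl
    have cx := hcolJ x
    have cy := hcolJ y
    have s := @J.symm'
    have t := @J.trans'
    constructor
    · intro hxy
      by_cases hx : column x = hi i <;> by_cases hy : column y = hi i
      · exact Or.inl ⟨hxy, by simp [hx, hy]⟩
      · exact Or.inr ⟨Or.inr ⟨cx hx, by simp [hx, hh]⟩,
          Or.inl ⟨t (s hxy) (t (cx hx) (s h)), by simp [hy, hl]⟩⟩
      · exact Or.inr ⟨Or.inl ⟨t hxy (t (cy hy) (s h)), by simp [hx, hl]⟩,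
          Or.inr ⟨cy hy, by simp [hy, hh]⟩⟩
      · exact Or.inl ⟨hxy, by simp [hx, hy]⟩
    · have hm : ∀ z, (J z (Sum.inr (lo i)) ∧ (column z = hi i ↔
          column (Sum.inr (lo i) : Fin n ⊕ Fin n) = hi i) ∨ J z (Sum.inr (hi i)) ∧
          (column z = hi i ↔ column (Sum.inr (hi i) : Fin n ⊕ Fin n) = hi i)) →
          J z (Sum.inr (hi i)) := fun z hz => hz.elim (fun hz => t hz.1 h) fun hz => hz.1
      rintro (hxy | ⟨hx, hy⟩)
      · exact hxy.1
      · exact t (hm x hx) (s (hm y hy))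

theorem exists_eq_mul_letter {n : ℕ} {A : Set (Fin n)} {m : ℕ} (hm : m ∈ positions A) {J : Ptn n}
    (hp : IsPlanar J) (hJ : Supp (m + 1) J) (h : J * letter n m = J) :
    ∃ K : Ptn n, IsPlanar K ∧ Supp m K ∧
      (∀ c, J (Sum.inl c) (Sum.inr c) → K (Sum.inl c) (Sum.inr c)) ∧ J = K * letter n m := by
  rcases hm with ⟨i, -, rfl⟩ | ⟨i, rfl⟩
  · rw [letter, zigzag_even] at *
    exact exists_eq_mul_rPtn hp hJ h
  · rw [letter, zigzag_odd] at *
    exact exists_eq_mul_hPtn hp hJ h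

theorem isPlanar_of_mem_below {n : ℕ} {A : Set (Fin n)} {m : ℕ} {J : Ptn n}
    (hJ : J ∈ below (letter n) (positions A) m) : IsPlanar J := by
  refine (Submonoid.closure_le (S := planarPtn n)).2 ?_ hJ
  rintro _ ⟨l, ⟨⟨i, -, rfl⟩ | ⟨i, rfl⟩, -⟩, rfl⟩
  · rw [letter, zigzag_even]; exact isPlanar_rPtn i
  · rw [letter, zigzag_odd]; exact isPlanar_hPtn i

theorem mul_mem_below_straight {n : ℕ} {A : Set (Fin n)} {m : ℕ} {J K : Ptn n}
    (hJ : ∀ c ∉ A, J (Sum.inl c) (Sum.inr c)) (hK : K ∈ below (letter n) (positions A) m) :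
    ∀ c ∉ A, (J * K) (Sum.inl c) (Sum.inr c) := by
  induction hK using Submonoid.closure_induction_right with
  | one => rwa [mul_one]
  | mul_right K _ a ha ih =>
    intro c hc
    obtain ⟨l, ⟨⟨i, hi, rfl⟩ | ⟨i, rfl⟩, -⟩, rfl⟩ := ha <;> rw [← mul_assoc, letter]
    · rw [zigzag_even]
      refine (mul_rPtn_apply (J * K) i _ _).2 (Or.inr ⟨ih c hc, by simp, fun h => ?_⟩)
      obtain rfl := Sum.inr_injective h
      exact hc hi
    · rw [zigzag_odd]
      exact (mul_hPtn_apply (J * K) i _ _).2 (Or.inl (ih c hc))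

theorem mem_below_of_isPlanar {n : ℕ} {A : Set (Fin n)} (m : ℕ) :
    ∀ {J : Ptn n}, IsPlanar J → (∀ c ∉ A, J (Sum.inl c) (Sum.inr c)) → Supp m J →
      J ∈ below (letter n) (positions A) m := by
  have ht := jonesRel_letter A
  induction m with
  | zero =>
    intro J hp hA hJ
    suffices J = 1 from this ▸ one_mem _
    have hcol : ∀ x, J x (Sum.inr (column x)) := by
      rintro (x | x)
      exacts [hJ.1 x (Nat.zero_le _), J.refl' _]
    have hle : ∀ x y, J x y → column x < column y → False := by
      intro x y hxy hlt
      have hlt' : (column x : ℕ) < column y := hlt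
      exact hlt.ne (hJ.2 (column y) (by omega) x (J.trans' hxy (hcol y)))
    ext x y
    rw [one_apply]
    refine ⟨fun h => ?_, fun h => J.trans' (hcol x) ?_⟩
    · exact le_antisymm (not_lt.1 (hle y x (J.symm' h))) (not_lt.1 (hle x y h))
    · rw [show column x = column y from h]
      exact J.symm' (hcol y)
  | succ m ih =>
    intro J hp hA hJ
    by_cases hJ' : Supp m J
    · exact below_mono m.le_succ (ih hp hA hJ')
    obtain ⟨k, d, hk, hS, hJk⟩ := (hJ.leftBound hJ').exists_absorbed hp hA
    have hm : m ∈ positions A := hS m (by omega) hk.ge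
    have hasc : asc (letter n) k d ∈ below (letter n) (positions A) (m + 1) :=
      asc_mem hS (by omega)
    -- move the absorbed letter to the end of the run
    have hD : J * asc (letter n) k d * letter n m = J * asc (letter n) k d := by
      subst hk
      cases d with
      | zero => simpa only [asc, mul_one, add_zero] using hJk
      | succ d => rw [asc, mul_assoc, mul_assoc]; congr 2; exact ht.idem _ hm
    have hDS : Supp (m + 1) (J * asc (letter n) k d) := Supp.mul_mem_below hJ hasc
    obtain ⟨K, hKp, hKS, hKA, hK⟩ := exists_eq_mul_letter hm
      (hp.mul (isPlanar_of_mem_below hasc)) hDS hD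
    have hKmem := ih hKp (fun c hc => hKA c (mul_mem_below_straight hA hasc c hc)) hKS
    have : J = K * letter n m * desc (letter n) k d := by
      rw [← hK, mul_assoc]
      conv_lhs => rw [← hJk, ← ht.letter_mul_asc_mul_desc hS, ← mul_assoc, ← mul_assoc, hJk]
      rw [mul_assoc]
    rw [this]
    exact mul_mem (mul_mem (below_mono m.le_succ hKmem) (mem_below hm m.lt_succ_self))
      (desc_mem hS (by omega))

/-! ### The monoid generated by the partitions `r_i` -/

/-- The product of the partitions `r_i` with `i ∈ A`: singletons in the columns of `A`, vertical
lines in the other columns. -/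
abbrev cut {n : ℕ} (A : Set (Fin n)) : Ptn n where
  r x y := x = y ∨ (column x = column y ∧ column x ∉ A)
  iseqv := by
    refine ⟨fun _ => Or.inl rfl, ?_, ?_⟩ <;> grind

theorem cut_apply {n : ℕ} (A : Set (Fin n)) (x y : Fin n ⊕ Fin n) :
    cut A x y ↔ x = y ∨ (column x = column y ∧ column x ∉ A) := Iff.rfl

theorem cut_vertical {n : ℕ} (A : Set (Fin n)) (c : Fin n) :
    cut A (Sum.inl c) (Sum.inr c) ↔ c ∉ A := by
  simp [cut_apply, column]

theorem cut_injective {n : ℕ} : Function.Injective (cut : Set (Fin n) → Ptn n) := by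
  intro A B h
  ext c
  rw [← not_iff_not, ← cut_vertical, ← cut_vertical, h]

theorem cut_empty (n : ℕ) : cut (∅ : Set (Fin n)) = 1 := by
  ext x y
  rw [cut_apply, one_apply]
  simp only [column, Set.mem_empty_iff_false, not_false_eq_true, and_true]
  exact ⟨fun h => h.elim (fun h => h ▸ rfl) id, Or.inr⟩

theorem cut_mul_rPtn {n : ℕ} (A : Set (Fin n)) (i : Fin n) :
    cut A * rPtn i = cut (insert i A) := by
  ext (x | x) (y | y) <;> simp only [mul_rPtn_apply, cut_apply, column, Sum.elim_inl,
    Sum.elim_inr, id, Set.mem_insert_iff] <;> grind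

theorem cut_le_iff {n : ℕ} {A : Set (Fin n)} {J : Ptn n} :
    cut A ≤ J ↔ ∀ c ∉ A, J (Sum.inl c) (Sum.inr c) := by
  refine ⟨fun h c hc => h ((cut_vertical A c).2 hc), fun h => ?_⟩
  rintro (x | x) (y | y) (hxy | ⟨hxy, hx⟩)
  · exact hxy ▸ J.refl' _
  · obtain rfl : x = y := hxy
    exact J.refl' _
  · cases hxy
  · obtain rfl : x = y := hxy
    exact h x hx
  · cases hxy
  · obtain rfl : x = y := hxy
    exact J.symm' (h x hx)
  · exact hxy ▸ J.refl' _
  · obtain rfl : x = y := hxy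
    exact J.refl' _

theorem exists_eq_cut {n : ℕ} {I : Ptn n} (hI : I ∈ monoidI n) : ∃ A, I = cut A := by
  induction hI using Submonoid.closure_induction_right with
  | one => exact ⟨∅, (cut_empty n).symm⟩
  | mul_right I _ a ha ih =>
    obtain ⟨A, rfl⟩ := ih
    obtain ⟨i, rfl⟩ := ha
    exact ⟨insert i A, cut_mul_rPtn A i⟩

theorem rPtn_le_one {n : ℕ} (i : Fin n) : rPtn i ≤ 1 := by
  rintro x y (rfl | h)
  exacts [Setoid.refl' _ _, h.1]

theorem one_le_hPtn {n : ℕ} (i : Fin (n - 1)) : 1 ≤ hPtn i :=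
  fun _ _ h => Or.inl h

/-! ### The presented monoid -/

theorem genVal_respects_rel {n : ℕ} : ∀ a b : FreeMonoid (Gen n), Rel n a b →
    FreeMonoid.lift genVal a = FreeMonoid.lift genVal b := by
  intro a b h
  induction h with
  | r_idem i => simp [R, genVal, rPtn_mul_self]
  | r_comm i j => simp [R, genVal, rPtn_comm i j]
  | e_idem i => simp [E, genVal, hPtn_mul_self]
  | e_comm i j => simp [E, genVal, hPtn_comm i j]
  | q_idem i => simp [Q, genVal, rPtn_mul_self]
  | q_comm i j => simp [Q, genVal, rPtn_comm i j]
  | q_e i j => simp [Q, E, genVal]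
  | e_r_e i j h => simp [E, R, Q, genVal, hPtn_rPtn_hPtn i j h]
  | e_r i j h => simp [E, R, genVal, hPtn_rPtn_comm i j h]
  | r_q i j => simp [R, Q, genVal, rPtn_comm i j]
  | q_r i => simp [R, Q, genVal, rPtn_mul_self]
  | r_e_r i j h => simp [R, E, genVal, rPtn_hPtn_rPtn i j h, rPtn_mul_self]

/-- The homomorphism from the presented monoid to pairs of partitions. -/
def eval (n : ℕ) : PresentedMonoid (Rel n) →* Ptn n × Ptn n :=
  PresentedMonoid.lift genVal genVal_respects_rel

theorem eval_of {n : ℕ} (g : Gen n) : eval n (PresentedMonoid.of (Rel n) g) = genVal g :=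
  PresentedMonoid.lift_of _ _

theorem genVal_mem {n : ℕ} (g : Gen n) : genVal g ∈ planarRamified (monoidI n) := by
  have hr : ∀ i : Fin n, rPtn i ∈ monoidI n := fun i => Submonoid.subset_closure ⟨i, rfl⟩
  cases g with
  | r i => exact ⟨hr i, isPlanar_rPtn i, le_refl (rPtn i)⟩
  | q i => exact ⟨hr i, isPlanar_one n, rPtn_le_one i⟩
  | e i => exact ⟨one_mem _, isPlanar_hPtn i, one_le_hPtn i⟩

theorem closure_genVal (n : ℕ) :
    Submonoid.closure (Set.range (genVal : Gen n → _)) = MonoidHom.mrange (eval n) := by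
  rw [MonoidHom.mrange_eq_map, ← PresentedMonoid.closure_range_of, MonoidHom.map_mclosure,
    ← Set.range_comp]
  rfl

theorem mem_mrange_eval {n : ℕ} {p : Ptn n × Ptn n} (hp : p ∈ planarRamified (monoidI n)) :
    p ∈ MonoidHom.mrange (eval n) := by
  obtain ⟨I, J⟩ := p
  obtain ⟨hI, hJp, hIJ⟩ := hp
  obtain ⟨A, rfl⟩ := exists_eq_cut hI
  have hgen : ∀ g : Gen n, genVal g ∈ MonoidHom.mrange (eval n) := fun g => ⟨_, eval_of g⟩
  have hJ : J ∈ below (letter n) (positions A) (2 * n - 1) :=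
    mem_below_of_isPlanar _ hJp (cut_le_iff.1 hIJ)
      ⟨fun c hc => by have := c.isLt; omega, fun c hc => by have := c.isLt; omega⟩
  clear hIJ hJp
  induction hJ using Submonoid.closure_induction_right with
  | one =>
    clear hI
    induction A, Set.toFinite A using Set.Finite.induction_on with
    | empty => rw [cut_empty]; exact one_mem _
    | @insert i A _ _ ih =>
      rw [← cut_mul_rPtn, ← mul_one (1 : Ptn n)]
      exact mul_mem ih (hgen (Gen.q i))
  | mul_right J _ a ha ih =>
    obtain ⟨l, ⟨⟨i, hi, rfl⟩ | ⟨i, rfl⟩, -⟩, rfl⟩ := ha <;> rw [letter]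
    · rw [zigzag_even, ← Set.insert_eq_of_mem hi, ← cut_mul_rPtn]
      exact mul_mem (ih ‹_›) (hgen (Gen.r i))
    · rw [zigzag_odd, ← mul_one (cut A)]
      exact mul_mem (ih ‹_›) (hgen (Gen.e i))

/-- The letters `r_i` in the presented monoid. -/
abbrev mr {n : ℕ} (i : Fin n) : PresentedMonoid (Rel n) := PresentedMonoid.of _ (Gen.r i)
/-- The letters `q_i` in the presented monoid. -/
abbrev mq {n : ℕ} (i : Fin n) : PresentedMonoid (Rel n) := PresentedMonoid.of _ (Gen.q i)
/-- The letters `e_i` in the presented monoid. -/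
abbrev me {n : ℕ} (i : Fin (n - 1)) : PresentedMonoid (Rel n) := PresentedMonoid.of _ (Gen.e i)

@[elab_as_elim]
theorem induction_mul_right {n : ℕ} {P : PresentedMonoid (Rel n) → Prop}
    (w : PresentedMonoid (Rel n)) (one : P 1) (r : ∀ w i, P w → P (w * mr i))
    (q : ∀ w i, P w → P (w * mq i)) (e : ∀ w i, P w → P (w * me i)) : P w := by
  have hw : w ∈ Submonoid.closure (Set.range (PresentedMonoid.of (Rel n))) := by
    rw [PresentedMonoid.closure_range_of]; trivial
  induction hw using Submonoid.closure_induction_right with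
  | one => exact one
  | mul_right w _ a ha ih =>
    obtain ⟨i | i | i, rfl⟩ := ha
    exacts [r w i ih, q w i ih, e w i ih]

theorem mq_central {n : ℕ} (i : Fin n) (w : PresentedMonoid (Rel n)) : mq i * w = w * mq i := by
  induction w using induction_mul_right with
  | one => simp
  | r w j ih =>
    have : mr j * mq i = mq i * mr j := PresentedMonoid.mk_eq_mk_of_rel (Rel.r_q j i)
    rw [← mul_assoc, ih, mul_assoc, ← this, mul_assoc]
  | q w j ih =>
    have : mq i * mq j = mq j * mq i := PresentedMonoid.mk_eq_mk_of_rel (Rel.q_comm i j)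
    rw [← mul_assoc, ih, mul_assoc, this, mul_assoc]
  | e w j ih =>
    have : mq i * me j = me j * mq i := PresentedMonoid.mk_eq_mk_of_rel (Rel.q_e i j)
    rw [← mul_assoc, ih, mul_assoc, this, mul_assoc]

/-- `c` is a central idempotent absorbing the letters `q_i` with `i ∈ A`. -/
structure IsCutIdem {n : ℕ} (A : Set (Fin n)) (c : PresentedMonoid (Rel n)) : Prop where
  central : ∀ w, c * w = w * c
  idem : c * c = c
  absorb : ∀ i ∈ A, c * mq i = c

/-- The product of the letters `q_i` with `i ∈ A`. -/
theorem exists_isCutIdem {n : ℕ} (A : Set (Fin n)) : ∃ c, IsCutIdem A c ∧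
    (∀ w, (∀ i ∈ A, mq i * w = w) → c * w = w) ∧ (eval n c).2 = 1 := by
  induction A, Set.toFinite A using Set.Finite.induction_on with
  | empty => exact ⟨1, ⟨by simp, by simp, by simp⟩, by simp, by simp⟩
  | @insert i A _ _ ih =>
    obtain ⟨c, hc, h1, h2⟩ := ih
    have qq : mq i * mq i = mq i := PresentedMonoid.mk_eq_mk_of_rel (Rel.q_idem i)
    refine ⟨c * mq i, ⟨fun w => ?_, ?_, ?_⟩, fun w hw => ?_, ?_⟩
    · rw [mul_assoc, mq_central, ← mul_assoc, hc.central, mul_assoc]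
    · rw [mul_assoc, ← mul_assoc (mq i), mq_central, mul_assoc, qq, ← mul_assoc, hc.idem]
    · rintro j (rfl | hj)
      · rw [mul_assoc, qq]
      · rw [mul_assoc, mq_central, ← mul_assoc, hc.absorb j hj]
    · rw [mul_assoc, hw i (Or.inl rfl)]
      exact h1 w fun j hj => hw j (Or.inr hj)
    · rw [map_mul, Prod.snd_mul, h2, eval_of]
      exact one_mul 1

namespace IsCutIdem

variable {n : ℕ} {A : Set (Fin n)} {c : PresentedMonoid (Rel n)} (hc : IsCutIdem A c)
include hc

theorem mul_mul_mul (x y : PresentedMonoid (Rel n)) : c * x * (c * y) = c * (x * y) := by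
  rw [mul_assoc, ← mul_assoc x, ← hc.central x, mul_assoc, ← mul_assoc, hc.idem]

/-- After multiplication by `c`, the letters `e_i` and the letters `r_i` with `i ∈ A` satisfy the
Jones relations, since the factor `q_j` in `e_i r_j e_i = e_i q_j` is absorbed. -/
theorem jonesRel : JonesRel (zigzag (fun i => c * mr i) (fun i => c * me i)) (positions A) := by
  refine jonesRel_zigzag (fun i _ => ?_) (fun i _ j _ => ?_) (fun i => ?_) (fun i j => ?_)
    (fun i j _ h => ?_) (fun i j hj h => ?_) (fun i j _ h => ?_) <;> simp only [hc.mul_mul_mul]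
  · exact congrArg (c * ·) (PresentedMonoid.mk_eq_mk_of_rel (Rel.r_idem i))
  · exact congrArg (c * ·) (PresentedMonoid.mk_eq_mk_of_rel (Rel.r_comm i j))
  · exact congrArg (c * ·) (PresentedMonoid.mk_eq_mk_of_rel (Rel.e_idem i))
  · exact congrArg (c * ·) (PresentedMonoid.mk_eq_mk_of_rel (Rel.e_comm i j))
  · exact congrArg (c * ·) (PresentedMonoid.mk_eq_mk_of_rel (Rel.e_r i j h))
  · have : me i * mr j * me i = me i * mq j := PresentedMonoid.mk_eq_mk_of_rel (Rel.e_r_e i j h)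
    rw [this, ← mq_central, ← mul_assoc, hc.absorb j hj]
  · exact congrArg (c * ·) (PresentedMonoid.mk_eq_mk_of_rel (Rel.r_e_r i j h))

end IsCutIdem

/-- The content of an element of the presented monoid: a set `A` such that the letters `q_i` with
`i ∈ A` are absorbed, and such that in their presence the element can be written in the letters
`e_i` and the letters `r_i` with `i ∈ A`. -/
theorem exists_content {n : ℕ} (w : PresentedMonoid (Rel n)) : ∃ A, (eval n w).1 = cut A ∧
    (∀ i ∈ A, mq i * w = w) ∧ ∀ B c, A ⊆ B → IsCutIdem B c →
      ∃ z ∈ below (zigzag (fun i => c * mr i) fun i => c * me i) (positions B) (2 * n - 1),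
        c * w = c * z := by
  induction w using induction_mul_right with
  | one =>
    exact ⟨∅, by rw [cut_empty]; simp, by simp, fun B c _ _ => ⟨1, one_mem _, rfl⟩⟩
  | r w i ih =>
    obtain ⟨A, h1, h2, h3⟩ := ih
    refine ⟨insert i A, ?_, ?_, fun B c hB hc => ?_⟩
    · rw [map_mul, Prod.fst_mul, h1, eval_of, ← cut_mul_rPtn]; rfl
    · have qr : mq i * mr i = mr i := PresentedMonoid.mk_eq_mk_of_rel (Rel.q_r i)
      rintro j (rfl | hj)
      · rw [← mul_assoc, mq_central, mul_assoc, qr]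
      · rw [← mul_assoc, h2 j hj]
    · obtain ⟨z, hz, h⟩ := h3 B c ((Set.subset_insert i A).trans hB) hc
      refine ⟨z * zigzag _ _ (2 * (i : ℕ)), mul_mem hz (mem_below
        (Or.inl ⟨i, hB (Set.mem_insert i A), rfl⟩) (by omega)), ?_⟩
      rw [zigzag_even, ← mul_assoc, h, ← mul_assoc c z, hc.mul_mul_mul, mul_assoc]
  | q w i ih =>
    obtain ⟨A, h1, h2, h3⟩ := ih
    refine ⟨insert i A, ?_, ?_, fun B c hB hc => ?_⟩
    · rw [map_mul, Prod.fst_mul, h1, eval_of, ← cut_mul_rPtn]; rfl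
    · have qq : mq i * mq i = mq i := PresentedMonoid.mk_eq_mk_of_rel (Rel.q_idem i)
      rintro j (rfl | hj)
      · rw [← mul_assoc, mq_central, mul_assoc, qq]
      · rw [← mul_assoc, h2 j hj]
    · obtain ⟨z, hz, h⟩ := h3 B c ((Set.subset_insert i A).trans hB) hc
      refine ⟨z, hz, ?_⟩
      rw [← mq_central, ← mul_assoc, hc.absorb i (hB (Set.mem_insert i A)), h]
  | e w i ih =>
    obtain ⟨A, h1, h2, h3⟩ := ih
    refine ⟨A, ?_, fun j hj => by rw [← mul_assoc, h2 j hj], fun B c hB hc => ?_⟩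
    · rw [map_mul, Prod.fst_mul, h1, eval_of]; exact mul_one _
    · obtain ⟨z, hz, h⟩ := h3 B c hB hc
      refine ⟨z * zigzag _ _ (2 * (i : ℕ) + 1), mul_mem hz (mem_below
        (Or.inr ⟨i, rfl⟩) (by omega)), ?_⟩
      rw [zigzag_odd, ← mul_assoc, h, ← mul_assoc c z, hc.mul_mul_mul, mul_assoc]

theorem eval_injective (n : ℕ) : Function.Injective (eval n) := by
  intro w w' h
  obtain ⟨A, h1, h2, h3⟩ := exists_content w
  obtain ⟨A', h1', h2', h3'⟩ := exists_content w'
  obtain rfl : A = A' := cut_injective (by rw [← h1, ← h1', h])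
  obtain ⟨c, hc, hcw, hc1⟩ := exists_isCutIdem A
  obtain ⟨z, hz, hwz⟩ := h3 A c subset_rfl hc
  obtain ⟨z', hz', hwz'⟩ := h3' A c subset_rfl hc
  rw [hcw w h2] at hwz
  rw [hcw w' h2'] at hwz'
  let f : PresentedMonoid (Rel n) →* Ptn n := (MonoidHom.snd _ _).comp (eval n)
  have hfc : f c = 1 := hc1
  have hf : ∀ l, f (zigzag (fun i => c * mr i) (fun i => c * me i) l) = letter n l := by
    intro l
    rw [map_zigzag]
    simp only [map_mul, hfc, one_mul]
    rfl
  have hzz : z = z' := by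
    refine injOn_below_of_letter hc.jonesRel f hf _ z hz z' hz' ?_
    have : f (c * z) = f (c * z') := by
      rw [← hwz, ← hwz']
      exact congrArg Prod.snd h
    simpa only [map_mul, hfc, one_mul] using this
  rw [hwz, hwz', hzz]

end PlanarRam

theorem mainTheorem3 (n : ℕ) :
    Submonoid.closure (Set.range (PlanarRam.genVal : PlanarRam.Gen n → _)) =
        PlanarRam.planarRamified (PlanarRam.monoidI n) ∧
      ∃ φ : PresentedMonoid (PlanarRam.Rel n) ≃*
          PlanarRam.planarRamified (PlanarRam.monoidI n),
        ∀ g : PlanarRam.Gen n,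
          ((φ (PresentedMonoid.of (PlanarRam.Rel n) g) :
            PlanarRam.planarRamified (PlanarRam.monoidI n)) : PlanarRam.Ptn n × PlanarRam.Ptn n) =
            PlanarRam.genVal g := by
  have hcl : Submonoid.closure (Set.range (PlanarRam.genVal : PlanarRam.Gen n → _)) =
      PlanarRam.planarRamified (PlanarRam.monoidI n) := by
    refine le_antisymm (Submonoid.closure_le.2 ?_) fun p hp => ?_
    · rintro _ ⟨g, rfl⟩
      exact PlanarRam.genVal_mem g
    · rw [PlanarRam.closure_genVal]
      exact PlanarRam.mem_mrange_eval hp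
  have hrange : MonoidHom.mrange (PlanarRam.eval n) =
      PlanarRam.planarRamified (PlanarRam.monoidI n) := by
    rw [← PlanarRam.closure_genVal, hcl]
  refine ⟨hcl, MulEquiv.ofBijective ((PlanarRam.eval n).codRestrict
    (PlanarRam.planarRamified (PlanarRam.monoidI n)) fun w => hrange ▸ ⟨w, rfl⟩)
    ⟨fun w w' h => PlanarRam.eval_injective n (congrArg Subtype.val h), ?_⟩,
    fun g => PlanarRam.eval_of g⟩
  rintro ⟨p, hp⟩
  obtain ⟨w, rfl⟩ := PlanarRam.mem_mrange_eval hp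
  exact ⟨w, rfl⟩
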